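/- For $n\ge 0$ let $C_n$ be the number of key comparisons that Quicksort (with the first element of each list as its pivot, the two sublists keeping the order of the input) needs to sort a uniformly random permutation of size $n$, and let $$Z_n:=\frac{C_n-\mathbb{E}(C_n)}{n+1}.$$ Then $Z_n$ converges in distribution, as $n\to\infty$, to a (necessarily unique) limit law $Z_\infty$ on $\mathbb{R}$. For every integer $s\ge 0$ the moment $\mathbb{E}(Z_\infty^s)$ exists (that is, $\mathbb{E}|Z_\infty|^s<\infty$) and is a polynomial with rational coefficients in the zeta values $\zeta(2),\zeta(3),\zeta(4),\dots$: there is a polynomial $P_s$ with rational coefficients in finitely many of the variables $X_2,X_3,\dots$ such that $$\mathbb{E}(Z_\infty^s)=P_s\bigl(\zeta(2),\zeta(3),\dots\bigr).$$ -/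

import Mathlib

open MeasureTheory Filter Topology

/-- The number of key comparisons that Quicksort needs to sort a list. The first element `x` is the
pivot; it is compared once with each of the other elements, which are thereby split into those
smaller than `x` and the others, and the two sublists (in their original order) are then sorted
recursively. Lists of length `0` and `1` need no comparison. -/
def quicksortComparisons {α : Type*} [LinearOrder α] : List α → ℕ
  | [] => 0
  | x :: xs =>
      xs.length + quicksortComparisons (xs.filter (fun y => y < x)) +
        quicksortComparisons (xs.filter (fun y => x ≤ y))
  termination_by l => l.length
  decreasing_by
    all_goals
      simp only [List.length_unattach, List.length_cons, Nat.lt_succ_iff]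
      exact (List.length_filter_le _ _).trans (by simp)

/-- `C_n` on the sample space of all permutations `σ` of size `n`: the number of comparisons that
Quicksort needs on the input list `σ(0), …, σ(n-1)`. -/
def quicksortC (n : ℕ) (σ : Equiv.Perm (Fin n)) : ℕ :=
  quicksortComparisons (List.ofFn fun i => σ i)

/-- The expected value `E(C_n)` when the input is a uniformly random permutation of size `n`. -/
noncomputable def quicksortMean (n : ℕ) : ℝ :=
  (∑ σ : Equiv.Perm (Fin n), (quicksortC n σ : ℝ)) / (Nat.factorial n : ℝ)

/-- The centered and normalized number of comparisons `Z_n = (C_n - E(C_n)) / (n + 1)`. -/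
noncomputable def quicksortZ (n : ℕ) (σ : Equiv.Perm (Fin n)) : ℝ :=
  ((quicksortC n σ : ℝ) - quicksortMean n) / ((n : ℝ) + 1)

/-- The law of `Z_n` for a uniformly random permutation of size `n`. -/
noncomputable def quicksortZLaw (n : ℕ) : ProbabilityMeasure ℝ :=
  ⟨((PMF.uniformOfFintype (Equiv.Perm (Fin n))).map (quicksortZ n)).toMeasure, inferInstance⟩

/-- `μ` is the limit law `Z_∞` of Quicksort: the `Z_n` converge to it in distribution. Limits in
distribution are unique, so there is at most one such `μ`. -/
def IsQuicksortLimitLaw (μ : ProbabilityMeasure ℝ) : Prop :=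
  Tendsto quicksortZLaw atTop (𝓝 μ)

/-- A real number is a rational polynomial in the zeta values `ζ(2), ζ(3), …`: it is obtained from
a polynomial with rational coefficients in finitely many of the variables `X_0, X_1, …` by
substituting `ζ(k + 2)` for `X_k`. -/
def IsRationalPolynomialInZetaValues (x : ℝ) : Prop :=
  ∃ P : MvPolynomial ℕ ℚ,
    (x : ℂ) = MvPolynomial.aeval (fun k : ℕ => riemannZeta ((k : ℂ) + 2)) P

/-! Given the rank of the first pivot, the two sublists are independent and uniformly ordered. With
the normalization by `n + 1` this gives `Z_{n+1} = a Z_i + (1 - a) Z'_{n-i} + toll`, where `i` is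
uniform on `0, …, n` and `a = (i + 1) / (n + 2)`; the toll is bounded and has mean zero
(`quicksortNormalize_split`, `sum_quicksortToll`). An induction bounds `E exp(t Z_n)` uniformly in
`n` for small `t` (`exp_transform_le`), so all absolute moments are uniformly bounded.

Since `E Z_n = 0`, the characteristic functions are `1 + O(t ^ 2)` uniformly in `n`. A bound `M t ^
2` on their asymptotic oscillation passes through the recursion with the factor `∫ (u ^ 2 + (1 - u)
^ 2) = 2 / 3`, so they converge pointwise (`charFun_oscillation_step`), and tightness yields the
limit law. It is the law of `U Z + (1 - U) Z' + g(U)`, with `U` uniform, `Z, Z'` independent copies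
and `g` the `limitToll` (`IsQuicksortLimitLaw.eq_map`).

Expanding the `s`-th power, the `s`-th moment occurs on the right with total coefficient `2 / (s +
1)`. For `s ≥ 2` it is therefore a rational combination of products of lower moments and integrals
of `u ^ k (1 - u) ^ l g(u) ^ j`. These integrals are rational combinations of mixed partial
derivatives of the Beta function at positive integers. Each such derivative is Beta times a
polynomial in digamma differences and Hurwitz zeta values (`exists_betaRing`), which at positive
integers are rational numbers and values `ζ(m)` minus rationals. -/

/-! ### Orderings of a finite set and the Quicksort recursion. -/

/-- The finset of all lists that enumerate `S` without repetition. -/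
def orderings {α : Type*} [DecidableEq α] (S : Finset α) : Finset (List α) :=
  ⟨S.val.lists, Multiset.lists_nodup_finset S⟩

theorem mem_orderings {α : Type*} [DecidableEq α] {S : Finset α} {l : List α} :
    l ∈ orderings S ↔ S.val = (l : Multiset α) := by
  exact Multiset.mem_lists_iff _ _

theorem orderings_empty {α : Type*} [DecidableEq α] : orderings (∅ : Finset α) = {[]} := by
  ext l
  simp [mem_orderings, eq_comm]

theorem cons_mem_orderings {α : Type*} [DecidableEq α] {S : Finset α} {x : α} {l : List α} :
    x :: l ∈ orderings S ↔ x ∈ S ∧ l ∈ orderings (S.erase x) := by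
  simp only [mem_orderings, Finset.erase_val]
  constructor
  · intro h
    have hx : x ∈ S := by
      rw [← Finset.mem_val, h]; simp
    refine ⟨hx, ?_⟩
    rw [h]; simp
  · rintro ⟨hx, h⟩
    rw [← Multiset.cons_coe, ← h, Multiset.cons_erase (show x ∈ S.val from hx)]

theorem sum_orderings {α M : Type*} [DecidableEq α] [AddCommMonoid M] {S : Finset α}
    (hS : S.Nonempty) (F : List α → M) :
    ∑ l ∈ orderings S, F l = ∑ x ∈ S, ∑ l ∈ orderings (S.erase x), F (x :: l) := by
  have h : orderings S =
      S.biUnion (fun x => (orderings (S.erase x)).image (List.cons x)) := by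
    ext l
    simp only [Finset.mem_biUnion, Finset.mem_image]
    constructor
    · intro hl
      cases l with
      | nil =>
        rw [mem_orderings] at hl
        simp only [Multiset.coe_nil, Finset.val_eq_zero] at hl
        exact absurd hl hS.ne_empty
      | cons x l => exact ⟨x, (cons_mem_orderings.1 hl).1, l, (cons_mem_orderings.1 hl).2, rfl⟩
    · rintro ⟨x, hx, l, hl, rfl⟩
      exact cons_mem_orderings.2 ⟨hx, hl⟩
  rw [h, Finset.sum_biUnion]
  · refine Finset.sum_congr rfl fun x _ => Finset.sum_image ?_
    intro a _ b _ hab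
    exact (List.cons.inj hab).2
  · intro x _ y _ hxy
    rw [Function.onFun, Finset.disjoint_left]
    intro l hl hl'
    obtain ⟨a, -, rfl⟩ := Finset.mem_image.1 hl
    obtain ⟨b, -, hb⟩ := Finset.mem_image.1 hl'
    exact hxy (List.cons.inj hb).1.symm

/-- Splitting an ordering of `S` by a predicate: every pair of orderings of the two parts arises
from the same number of orderings of `S`. -/
theorem sum_orderings_filter {α M : Type*} [DecidableEq α] [AddCommMonoid M] (p : α → Prop)
    [DecidablePred p] (S : Finset α) (F : List α → List α → M) :
    ∑ l ∈ orderings S, F (l.filter (fun y => decide (p y))) (l.filter (fun y => decide (¬ p y))) =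
      S.card.choose (S.filter p).card •
        ∑ a ∈ orderings (S.filter p), ∑ b ∈ orderings (S.filter fun y => ¬ p y), F a b := by
  induction h : S.card generalizing S F with
  | zero =>
    rw [Finset.card_eq_zero] at h
    subst h
    simp [orderings_empty]
  | succ n ih =>
    have hS : S.Nonempty := Finset.card_pos.1 (by omega)
    rw [sum_orderings hS, ← Finset.sum_filter_add_sum_filter_not S p]
    set A := S.filter p with hA
    set B := S.filter (fun y => ¬ p y) with hB
    have hcard : A.card + B.card = n + 1 := by
      rw [hA, hB, Finset.card_filter_add_card_filter_not, h]
    have h1 : ∀ x ∈ A, ∑ l ∈ orderings (S.erase x),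
        F ((x :: l).filter (fun y => decide (p y))) ((x :: l).filter (fun y => decide (¬ p y))) =
        n.choose (A.card - 1) • ∑ a ∈ orderings (A.erase x), ∑ b ∈ orderings B, F (x :: a) b := by
      intro x hx
      have hxS := (Finset.mem_filter.1 hx).1
      have hxp := (Finset.mem_filter.1 hx).2
      have e := ih (S.erase x) (fun a b => F (x :: a) b) (by rw [Finset.card_erase_of_mem hxS, h]; rfl)
      rw [Finset.filter_erase, Finset.filter_erase, ← hA, ← hB,
        Finset.erase_eq_of_notMem (s := B) (by simp [hB, hxp]), Finset.card_erase_of_mem hx] at e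
      rw [← e]
      refine Finset.sum_congr rfl fun l _ => ?_
      simp [hxp]
    have h2 : ∀ x ∈ B, ∑ l ∈ orderings (S.erase x),
        F ((x :: l).filter (fun y => decide (p y))) ((x :: l).filter (fun y => decide (¬ p y))) =
        n.choose A.card • ∑ b ∈ orderings (B.erase x), ∑ a ∈ orderings A, F a (x :: b) := by
      intro x hx
      have hxS := (Finset.mem_filter.1 hx).1
      have hxp := (Finset.mem_filter.1 hx).2
      have e := ih (S.erase x) (fun a b => F a (x :: b)) (by rw [Finset.card_erase_of_mem hxS, h]; rfl)
      rw [Finset.filter_erase, Finset.filter_erase, ← hA, ← hB,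
        Finset.erase_eq_of_notMem (s := A) (by simp [hA, hxp])] at e
      rw [Finset.sum_comm, ← e]
      refine Finset.sum_congr rfl fun l _ => ?_
      simp [hxp]
    rw [Finset.sum_congr rfl h1, Finset.sum_congr rfl h2, ← Finset.smul_sum, ← Finset.smul_sum]
    -- The empty cases are separate: `sum_orderings` needs a nonempty set, and `A.card - 1`
    -- truncates when `A` is empty.
    rcases A.eq_empty_or_nonempty with hA0 | hA0
    · rw [hA0] at hcard ⊢
      have hBn : B.Nonempty := Finset.card_pos.1 (by simp at hcard; omega)
      simp [orderings_empty, sum_orderings hBn]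
    rcases B.eq_empty_or_nonempty with hB0 | hB0
    · rw [hB0] at hcard ⊢
      have : A.card = n + 1 := by simpa using hcard
      simp [orderings_empty, sum_orderings hA0, this]
    · rw [← sum_orderings hA0 (fun l => ∑ b ∈ orderings B, F l b),
        ← sum_orderings hB0 (fun l => ∑ a ∈ orderings A, F a l), Finset.sum_comm (s := orderings B),
        ← add_smul]
      have := hA0.card_pos
      obtain ⟨k, hk⟩ : ∃ k, A.card = k + 1 := ⟨A.card - 1, by omega⟩
      -- The first element of the list lies in `A` or in `B`; Pascal's rule adds the two counts.
      rw [hk, Nat.choose_succ_succ]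
      rfl

/-- The ranks in `S` run once through `0, …, |S| - 1`; adjoining a new maximum leaves the other
ranks unchanged. -/
theorem sum_card_filter_lt {α M : Type*} [LinearOrder α] [AddCommMonoid M] (S : Finset α)
    (h : ℕ → M) :
    ∑ x ∈ S, h (S.filter (· < x)).card = ∑ i ∈ Finset.range S.card, h i := by
  induction S using Finset.induction_on_max with
  | empty => simp
  | insert a s ha ih =>
    have has : a ∉ s := fun hh => lt_irrefl _ (ha a hh)
    rw [Finset.sum_insert has, Finset.card_insert_of_notMem has, Finset.sum_range_succ, add_comm,
      ← ih]
    congr 1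
    · refine Finset.sum_congr rfl fun x hx => ?_
      rw [Finset.filter_insert, if_neg (not_lt.2 (ha x hx).le)]
    · rw [Finset.filter_insert, if_neg (lt_irrefl a), Finset.filter_true_of_mem ha]

/-- The sum of `f (C_n)` over all permutations, computed by the Quicksort recursion. -/
def quicksortSum {M : Type*} [AddCommMonoid M] : ℕ → (ℕ → M) → M
  | 0, f => f 0
  | n + 1, f => ∑ i : Fin (n + 1), n.choose i •
      quicksortSum i (fun a => quicksortSum (n - i) (fun b => f (n + a + b)))
  termination_by n => n
  decreasing_by all_goals omega

theorem quicksortComparisons_cons {α : Type*} [LinearOrder α] (x : α) (xs : List α) :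
    quicksortComparisons (x :: xs) = xs.length + quicksortComparisons (xs.filter (fun y => y < x)) +
        quicksortComparisons (xs.filter (fun y => ¬ y < x)) := by
  rw [quicksortComparisons]
  simp only [not_lt]

/-- For a pivot of rank `i`, each pair of sublist orderings comes from `n.choose i` interleavings,
which is the weight in `quicksortSum`. The function `f` must vary in the induction because each
level shifts its argument. -/
theorem sum_orderings_quicksort {α M : Type*} [LinearOrder α] [AddCommMonoid M] (S : Finset α)
    (f : ℕ → M) :
    ∑ l ∈ orderings S, f (quicksortComparisons l) = quicksortSum S.card f := by
  induction hn : S.card using Nat.strong_induction_on generalizing S f with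
  | _ n ih =>
    cases n with
    | zero =>
      rw [Finset.card_eq_zero] at hn
      subst hn
      simp [orderings_empty, quicksortSum, quicksortComparisons]
    | succ n =>
      rw [sum_orderings (Finset.card_pos.1 (by omega)), quicksortSum,
        Finset.sum_range (n := n + 1) (fun i => n.choose i •
          quicksortSum i (fun a => quicksortSum (n - i) (fun b => f (n + a + b)))) |>.symm, ← hn,
        ← sum_card_filter_lt]
      refine Finset.sum_congr rfl fun x hx => ?_
      have hc : (S.erase x).card = n := by rw [Finset.card_erase_of_mem hx, hn]; rfl
      have hlen : ∀ l ∈ orderings (S.erase x), l.length = n := by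
        intro l hl
        rw [← hc, Finset.card_def, mem_orderings.1 hl, Multiset.coe_card]
      have e := sum_orderings_filter (fun y => y < x) (S.erase x)
        (fun a b => f (n + quicksortComparisons a + quicksortComparisons b))
      have hf : (S.erase x).filter (fun y => y < x) = S.filter (fun y => y < x) := by
        rw [Finset.filter_erase, Finset.erase_eq_of_notMem (by simp)]
      have hadd := Finset.card_filter_add_card_filter_not (s := S.erase x) (fun y => y < x)
      rw [hf, hc] at hadd
      rw [hf, hc] at e
      have e2 : ∑ l ∈ orderings (S.erase x), f (quicksortComparisons (x :: l)) =
          ∑ l ∈ orderings (S.erase x), f (n + quicksortComparisons (l.filter (fun y => y < x)) +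
            quicksortComparisons (l.filter (fun y => ¬ y < x))) := by
        refine Finset.sum_congr rfl fun l hl => ?_
        rw [quicksortComparisons_cons, hlen l hl]
      rw [e2, e]
      congr 1
      rw [← ih _ (by omega) (S.filter (fun y => y < x)) _ rfl]
      refine Finset.sum_congr rfl fun a _ => ?_
      rw [ih _ (by omega) ((S.erase x).filter fun y => ¬ y < x) (fun b => f (n + _ + b)) rfl]
      congr 1
      omega

theorem sum_perm_eq_sum_orderings {M : Type*} [AddCommMonoid M] (n : ℕ) (F : List (Fin n) → M) :
    ∑ σ : Equiv.Perm (Fin n), F (List.ofFn fun i => σ i) =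
      ∑ l ∈ orderings (Finset.univ : Finset (Fin n)), F l := by
  refine Finset.sum_bij (fun σ _ => List.ofFn fun i => σ i) ?_ ?_ ?_ (fun _ _ => rfl)
  · intro σ _
    rw [mem_orderings]
    have hnd : (List.ofFn fun i => σ i).Nodup := List.nodup_ofFn.2 σ.injective
    have : (Finset.univ : Finset (Fin n)) = ⟨(List.ofFn fun i => σ i : List (Fin n)), hnd⟩ := by
      ext x
      simp only [Finset.mem_univ, true_iff]
      exact List.mem_ofFn.2 ⟨σ.symm x, by simp⟩
    rw [this]
  · intro σ _ τ _ h
    ext i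
    exact congrArg Fin.val (congrFun (List.ofFn_injective h) i)
  · intro l hl
    rw [mem_orderings] at hl
    have hlen : l.length = n := by
      rw [← Multiset.coe_card, ← hl]; simp
    have hnd : l.Nodup := by
      rw [← Multiset.coe_nodup, ← hl]; exact Finset.univ.nodup
    have hinj : Function.Injective fun i : Fin n => l.get (i.cast hlen.symm) :=
      (List.nodup_iff_injective_get.1 hnd).comp (Fin.cast_injective _)
    refine ⟨Equiv.ofBijective _ (Finite.injective_iff_bijective.1 hinj), Finset.mem_univ _, ?_⟩
    refine List.ext_get (by simp [hlen]) fun k h₁ h₂ => ?_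
    simp

theorem sum_perm_quicksortC {M : Type*} [AddCommMonoid M] (n : ℕ) (f : ℕ → M) :
    ∑ σ : Equiv.Perm (Fin n), f (quicksortC n σ) = quicksortSum n f := by
  unfold quicksortC
  rw [sum_perm_eq_sum_orderings n (fun l => f (quicksortComparisons l)), sum_orderings_quicksort,
    Finset.card_univ, Fintype.card_fin]

/-! ### Averages over permutations and the expected number of comparisons. -/

section average

variable {𝕜 : Type*} [Field 𝕜]

/-- The average of `f (C_n)` over all permutations of size `n`. -/
def quicksortAvg (n : ℕ) (f : ℕ → 𝕜) : 𝕜 :=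
  (∑ σ : Equiv.Perm (Fin n), f (quicksortC n σ)) / (n.factorial : 𝕜)

theorem quicksortAvg_add (n : ℕ) (f g : ℕ → 𝕜) :
    quicksortAvg n (fun c => f c + g c) = quicksortAvg n f + quicksortAvg n g := by
  simp [quicksortAvg, Finset.sum_add_distrib, add_div]

theorem quicksortAvg_mul_left (n : ℕ) (k : 𝕜) (f : ℕ → 𝕜) :
    quicksortAvg n (fun c => k * f c) = k * quicksortAvg n f := by
  simp [quicksortAvg, ← Finset.mul_sum, mul_div_assoc]

theorem quicksortAvg_mul_right (n : ℕ) (k : 𝕜) (f : ℕ → 𝕜) :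
    quicksortAvg n (fun c => f c * k) = quicksortAvg n f * k := by
  simp only [mul_comm _ k, quicksortAvg_mul_left]

theorem quicksortAvg_const [CharZero 𝕜] (n : ℕ) (k : 𝕜) :
    quicksortAvg n (fun _ => k) = k := by
  have : (n.factorial : 𝕜) ≠ 0 := Nat.cast_ne_zero.2 n.factorial_ne_zero
  simp [quicksortAvg, Fintype.card_perm, this]

theorem quicksortAvg_zero (f : ℕ → 𝕜) : quicksortAvg 0 f = f 0 := by
  rw [quicksortAvg, sum_perm_quicksortC]
  simp [quicksortSum]

/-- Dividing by the factorials cancels the binomial weights, so the pivot rank becomes uniform and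
the two sublists independent. -/
theorem quicksortAvg_succ [CharZero 𝕜] (n : ℕ) (f : ℕ → 𝕜) :
    quicksortAvg (n + 1) f = (∑ i ∈ Finset.range (n + 1),
      quicksortAvg i (fun a => quicksortAvg (n - i) (fun b => f (n + a + b)))) / ((n : 𝕜) + 1) := by
  have h0 : ∀ k : ℕ, (k.factorial : 𝕜) ≠ 0 := fun k => Nat.cast_ne_zero.2 k.factorial_ne_zero
  have h1 : ((n : 𝕜) + 1) ≠ 0 := by exact_mod_cast n.succ_ne_zero
  simp only [quicksortAvg, ← Finset.sum_div]
  rw [sum_perm_quicksortC, quicksortSum, Finset.sum_range, Nat.factorial_succ, Nat.cast_mul,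
    ← div_div, div_right_comm, Finset.sum_div, Nat.cast_succ]
  congr 1
  refine Finset.sum_congr rfl fun i _ => ?_
  rw [sum_perm_quicksortC (i : ℕ)
    (fun a => ∑ σ : Equiv.Perm (Fin (n - i)), f (n + a + quicksortC (n - i) σ))]
  have e : ∀ a, ∑ σ : Equiv.Perm (Fin (n - i)), f (n + a + quicksortC (n - i) σ) =
      quicksortSum (n - i) (fun b => f (n + a + b)) := fun a =>
    sum_perm_quicksortC _ (fun b => f (n + a + b))
  simp only [e]
  rw [nsmul_eq_mul, div_div, div_eq_div_iff (h0 n) (mul_ne_zero (h0 _) (h0 _))]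
  have := Nat.choose_mul_factorial_mul_factorial (Nat.lt_succ_iff.1 i.2)
  rw [← this]
  push_cast
  ring

end average

theorem quicksortAvg_mono (n : ℕ) {f g : ℕ → ℝ} (h : ∀ c, f c ≤ g c) :
    quicksortAvg n f ≤ quicksortAvg n g :=
  div_le_div_of_nonneg_right (Finset.sum_le_sum fun _ _ => h _) (Nat.cast_nonneg _)

theorem norm_quicksortAvg_le (n : ℕ) (f : ℕ → ℂ) :
    ‖quicksortAvg n f‖ ≤ quicksortAvg n (fun c => ‖f c‖) := by
  rw [quicksortAvg, quicksortAvg, norm_div, Complex.norm_natCast]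
  exact div_le_div_of_nonneg_right (norm_sum_le _ _) (Nat.cast_nonneg _)

theorem quicksortMean_eq_avg (n : ℕ) : quicksortMean n = quicksortAvg n (fun c => (c : ℝ)) := rfl

theorem quicksortMean_succ (n : ℕ) : quicksortMean (n + 1) =
    (∑ i ∈ Finset.range (n + 1), ((n : ℝ) + quicksortMean i + quicksortMean (n - i))) /
      ((n : ℝ) + 1) := by
  simp only [quicksortMean_eq_avg]
  rw [quicksortAvg_succ]
  simp only [Nat.cast_add, quicksortAvg_add, quicksortAvg_const]

theorem quicksortMean_eq (n : ℕ) : quicksortMean n = 2 * (n + 1) * harmonic n - 4 * n := by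
  induction n using Nat.strong_induction_on with
  | _ n ih =>
    cases n with
    | zero => simp [quicksortMean_eq_avg, quicksortAvg_zero]
    | succ n =>
      rw [quicksortMean_succ]
      have hrefl : ∑ i ∈ Finset.range (n + 1), quicksortMean (n - i) =
          ∑ i ∈ Finset.range (n + 1), quicksortMean i := by
        simpa using Finset.sum_range_reflect quicksortMean (n + 1)
      -- Closed form of the partial sums of the claimed means, which turns the recursion into an
      -- algebraic identity.
      have hsum : ∀ m : ℕ, ∑ i ∈ Finset.range m, (2 * ((i : ℝ) + 1) * harmonic i - 4 * i) =
          m * (m + 1) * harmonic m - 5 / 2 * m ^ 2 + m / 2 := by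
        intro m
        induction m with
        | zero => simp
        | succ m ihm =>
          have : (m : ℝ) + 1 ≠ 0 := by positivity
          rw [Finset.sum_range_succ, ihm, harmonic_succ]
          push_cast
          field_simp
          ring
      rw [Finset.sum_add_distrib, Finset.sum_add_distrib, hrefl,
        Finset.sum_congr rfl fun i hi => ih i (Finset.mem_range.1 hi), hsum]
      have : (n : ℝ) + 1 ≠ 0 := by positivity
      rw [div_eq_iff this]
      simp
      ring

/-! ### The normalized recursion and its toll. -/

/-- The normalized value of `C_n` as a function of the number `c` of comparisons. -/
noncomputable def quicksortNormalize (n c : ℕ) : ℝ := ((c : ℝ) - quicksortMean n) / ((n : ℝ) + 1)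

/-- The normalized toll of the first partitioning step of `n + 1` keys when the pivot has rank
`i`. -/
noncomputable def quicksortToll (n i : ℕ) : ℝ :=
  ((n : ℝ) + quicksortMean i + quicksortMean (n - i) - quicksortMean (n + 1)) / ((n : ℝ) + 2)

/-- The normalization by `n + 1` makes the two weights sum to one, since `(i + 1) + (n - i + 1) = n
+ 2`. -/
theorem quicksortNormalize_split {n i : ℕ} (hi : i ≤ n) (a b : ℕ) :
    quicksortNormalize (n + 1) (n + a + b) =
      ((i : ℝ) + 1) / (n + 2) * quicksortNormalize i a +
      (1 - ((i : ℝ) + 1) / (n + 2)) * quicksortNormalize (n - i) b + quicksortToll n i := by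
  have h1 : (n : ℝ) + 2 ≠ 0 := by positivity
  have h2 : (i : ℝ) + 1 ≠ 0 := by positivity
  have h3 : (n : ℝ) - i + 1 ≠ 0 := by
    have : (i : ℝ) ≤ n := by exact_mod_cast hi
    linarith
  have h4 : (n : ℝ) + 1 + 1 ≠ 0 := by positivity
  simp only [quicksortNormalize, quicksortToll, Nat.cast_sub hi]
  push_cast
  field_simp
  ring

theorem sum_quicksortToll (n : ℕ) : ∑ i ∈ Finset.range (n + 1), quicksortToll n i = 0 := by
  have h1 : (n : ℝ) + 1 ≠ 0 := by positivity
  have := quicksortMean_succ n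
  rw [eq_div_iff h1] at this
  simp only [quicksortToll, ← Finset.sum_div]
  rw [Finset.sum_sub_distrib, ← this]
  simp
  left
  ring

/-- The same identity `(i + 1) + (n - i + 1) = n + 2` distributes `harmonic (n + 1)` over the two
parts. Only differences of harmonic numbers remain, and these stay controlled as `n` grows. -/
theorem quicksortToll_eq {n i : ℕ} (hi : i ≤ n) : quicksortToll n i =
    ((n : ℝ) + 4 - 2 * ((i + 1) * (harmonic (n + 1) - harmonic i)) -
      2 * ((n - i + 1) * (harmonic (n + 1) - harmonic (n - i)))) / (n + 2) := by
  rw [quicksortToll, quicksortMean_eq, quicksortMean_eq, quicksortMean_eq, Nat.cast_sub hi]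
  push_cast
  ring

theorem harmonic_sub_nonneg {k m : ℕ} (h : k ≤ m) : (harmonic k : ℝ) ≤ harmonic m := by
  induction h with
  | refl => rfl
  | step _ ih =>
    refine ih.trans ?_
    rw [harmonic_succ]
    push_cast
    simp
    positivity

/-- Each of the `m - k` reciprocals in the difference is at most `1 / (k + 1)`. -/
theorem mul_harmonic_sub_le {k m : ℕ} (h : k ≤ m) :
    ((k : ℝ) + 1) * (harmonic m - harmonic k) ≤ m - k := by
  induction h with
  | refl => simp
  | @step m hm ih =>
    have hk : (0 : ℝ) < (k : ℝ) + 1 := by positivity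
    have hm' : (k : ℝ) ≤ m := by exact_mod_cast hm
    have : ((k : ℝ) + 1) * ((m : ℝ) + 1)⁻¹ ≤ 1 := by
      rw [← div_eq_mul_inv, div_le_one (by positivity)]
      linarith
    rw [harmonic_succ]
    push_cast
    rw [add_sub_right_comm, mul_add]
    linarith

theorem abs_quicksortToll_le {n i : ℕ} (hi : i ≤ n) : |quicksortToll n i| ≤ 2 := by
  have hin : (i : ℝ) ≤ n := by exact_mod_cast hi
  have h1 := mul_harmonic_sub_le (k := i) (m := n + 1) (by omega)
  have h2 := mul_harmonic_sub_le (k := n - i) (m := n + 1) (by omega)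
  have h3 : 0 ≤ ((i : ℝ) + 1) * (harmonic (n + 1) - harmonic i) :=
    mul_nonneg (by positivity) (sub_nonneg.2 (harmonic_sub_nonneg (by omega)))
  have h4 : 0 ≤ ((n : ℝ) - i + 1) * (harmonic (n + 1) - harmonic (n - i)) :=
    mul_nonneg (by linarith) (sub_nonneg.2 (harmonic_sub_nonneg (by omega)))
  rw [Nat.cast_sub hi] at h2
  push_cast at h1 h2
  have hn : (0 : ℝ) < (n : ℝ) + 2 := by positivity
  have hn0 : (0 : ℝ) ≤ n := by positivity
  rw [quicksortToll_eq hi, abs_le, le_div_iff₀ hn, div_le_iff₀ hn]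
  constructor <;> linarith

/-! ### Uniform exponential moments. -/

/-- The multiplicative functional `E (e (t * Z_n))`. -/
noncomputable def quicksortTransform {𝕜 : Type*} [Field 𝕜] (e : ℝ → 𝕜) (n : ℕ) (t : ℝ) : 𝕜 :=
  quicksortAvg n (fun c => e (t * quicksortNormalize n c))

theorem quicksortTransform_succ {𝕜 : Type*} [Field 𝕜] [CharZero 𝕜] (e : ℝ → 𝕜)
    (he : ∀ x y, e (x + y) = e x * e y) (n : ℕ) (t : ℝ) :
    quicksortTransform e (n + 1) t = (∑ i ∈ Finset.range (n + 1),
      quicksortTransform e i (((i : ℝ) + 1) / (n + 2) * t) *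
      quicksortTransform e (n - i) ((1 - ((i : ℝ) + 1) / (n + 2)) * t) *
      e (t * quicksortToll n i)) / ((n : 𝕜) + 1) := by
  rw [quicksortTransform, quicksortAvg_succ]
  congr 1
  refine Finset.sum_congr rfl fun i hi => ?_
  have hi : i ≤ n := Nat.lt_succ_iff.1 (Finset.mem_range.1 hi)
  simp only [quicksortTransform]
  rw [mul_assoc, ← quicksortAvg_mul_right]
  congr 1
  ext a
  rw [← quicksortAvg_mul_right, ← quicksortAvg_mul_left]
  congr 1
  ext b
  rw [quicksortNormalize_split hi, ← he, ← he]
  congr 1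
  ring

theorem quicksortNormalize_zero : quicksortNormalize 0 0 = 0 := by
  simp [quicksortNormalize, quicksortMean_eq]

theorem sum_mul_reflect (n : ℕ) :
    ∑ i ∈ Finset.range (n + 1), ((i : ℝ) + 1) * (n - i + 1) =
      ((n : ℝ) + 1) * (n + 2) * (n + 3) / 6 := by
  have h1 : ∀ m : ℕ, ∑ i ∈ Finset.range m, (i : ℝ) = m * (m - 1) / 2 := by
    intro m
    induction m with
    | zero => simp
    | succ m ih => rw [Finset.sum_range_succ, ih]; push_cast; ring
  have h2 : ∀ m : ℕ, ∑ i ∈ Finset.range m, (i : ℝ) ^ 2 = m * (m - 1) * (2 * m - 1) / 6 := by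
    intro m
    induction m with
    | zero => simp
    | succ m ih => rw [Finset.sum_range_succ, ih]; push_cast; ring
  have : ∀ i : ℕ, ((i : ℝ) + 1) * (n - i + 1) = n * i - (i : ℝ) ^ 2 + (n + 1) := by
    intro i; ring
  simp only [this]
  rw [Finset.sum_add_distrib, Finset.sum_sub_distrib, ← Finset.mul_sum, h1, h2]
  simp
  ring

/-- By induction the two factors contribute `exp(30 t ^ 2 (a ^ 2 + (1 - a) ^ 2)) = exp(30 t ^ 2 - 60
t ^ 2 a (1 - a))`. The negative term averages to at most `-10 t ^ 2`, which pays for the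
second-order error of the toll factor; the first-order toll term averages to zero. -/
theorem exp_transform_le (n : ℕ) (t : ℝ) (ht : |t| ≤ 1 / 15) :
    quicksortTransform Real.exp n t ≤ Real.exp (30 * t ^ 2) := by
  induction n using Nat.strong_induction_on generalizing t with
  | _ n ih =>
    cases n with
    | zero =>
      simp [quicksortTransform, quicksortAvg_zero, quicksortNormalize_zero]
      positivity
    | succ n =>
      have hn2 : (0 : ℝ) < (n : ℝ) + 2 := by positivity
      have hn1 : (0 : ℝ) < (n : ℝ) + 1 := by positivity
      have ht2 : t ^ 2 ≤ 1 / 225 := by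
        rw [← sq_abs]
        nlinarith [abs_nonneg t]
      rw [quicksortTransform_succ _ Real.exp_add, div_le_iff₀ hn1]
      have key : ∀ i ∈ Finset.range (n + 1),
          quicksortTransform Real.exp i (((i : ℝ) + 1) / (n + 2) * t) *
          quicksortTransform Real.exp (n - i) ((1 - ((i : ℝ) + 1) / (n + 2)) * t) *
          Real.exp (t * quicksortToll n i) ≤
          Real.exp (30 * t ^ 2) * (1 + t * quicksortToll n i -
            60 * t ^ 2 / (n + 2) ^ 2 * (((i : ℝ) + 1) * (n - i + 1)) + 10 * t ^ 2) := by
        intro i hi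
        have hi' : i ≤ n := Nat.lt_succ_iff.1 (Finset.mem_range.1 hi)
        have hin : (i : ℝ) ≤ n := by exact_mod_cast hi'
        set a := ((i : ℝ) + 1) / (n + 2) with ha
        have ha0 : 0 ≤ a := by positivity
        have ha1 : a ≤ 1 := by rw [ha, div_le_one hn2]; linarith
        have hab : a * (1 - a) ≤ 1 / 4 := by nlinarith [sq_nonneg (a - 1 / 2)]
        have hab0 : 0 ≤ a * (1 - a) := mul_nonneg ha0 (by linarith)
        have hg := abs_le.1 (abs_quicksortToll_le hi')
        set g := quicksortToll n i
        have e1 := ih i (by omega) (a * t) (by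
          rw [abs_mul, abs_of_nonneg ha0]
          exact (mul_le_of_le_one_left (abs_nonneg _) ha1).trans ht)
        have e2 := ih (n - i) (by omega) ((1 - a) * t) (by
          rw [abs_mul, abs_of_nonneg (by linarith)]
          exact (mul_le_of_le_one_left (abs_nonneg _) (by linarith)).trans ht)
        have hpos : ∀ k s, 0 ≤ quicksortTransform Real.exp k s := fun k s =>
          div_nonneg (Finset.sum_nonneg fun _ _ => (Real.exp_pos _).le) (Nat.cast_nonneg _)
        have eab : ((i : ℝ) + 1) * (n - i + 1) = (n + 2) ^ 2 * (a * (1 - a)) := by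
          rw [ha]; field_simp; ring
        set x := t * g - 60 * t ^ 2 * (a * (1 - a)) with hx
        have htg : |t * g| ≤ 2 / 15 := by
          rw [abs_mul]
          have : |g| ≤ 2 := abs_le.2 hg
          nlinarith [abs_nonneg t, abs_nonneg g]
        have hw0 : 0 ≤ 60 * t ^ 2 * (a * (1 - a)) := by positivity
        have hw1 : 60 * t ^ 2 * (a * (1 - a)) ≤ 15 * t ^ 2 := by
          nlinarith [sq_nonneg t]
        have hx1 : |x| ≤ 1 := by
          have := abs_le.1 htg
          rw [abs_le]; constructor <;> linarith
        -- The bound is `2 * 4 t ^ 2 + 2 * 225 t ^ 4`, and `|t| ≤ 1 / 15` makes the last term at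
        -- most `2 t ^ 2`.
        have hx2 : x ^ 2 ≤ 10 * t ^ 2 := by
          have h1 : x ^ 2 ≤ 2 * (t * g) ^ 2 + 2 * (60 * t ^ 2 * (a * (1 - a))) ^ 2 := by
            rw [hx]; nlinarith [sq_nonneg (t * g + 60 * t ^ 2 * (a * (1 - a)))]
          have h2 : (t * g) ^ 2 ≤ 4 * t ^ 2 := by
            rw [mul_pow]
            have : g ^ 2 ≤ 4 := by nlinarith
            nlinarith [sq_nonneg t]
          have h3 : (60 * t ^ 2 * (a * (1 - a))) ^ 2 ≤ (15 * t ^ 2) ^ 2 := by gcongr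
          nlinarith [sq_nonneg t]
        have hexp : Real.exp x ≤ 1 + x + x ^ 2 := by
          have := (abs_le.1 (Real.abs_exp_sub_one_sub_id_le hx1)).2
          linarith
        calc _ ≤ Real.exp (30 * (a * t) ^ 2) * Real.exp (30 * ((1 - a) * t) ^ 2) *
              Real.exp (t * g) := by
              gcongr
              exact hpos _ _
          _ = Real.exp (30 * t ^ 2) * Real.exp x := by
              rw [← Real.exp_add, ← Real.exp_add, ← Real.exp_add]
              congr 1
              rw [hx]; ring
          _ ≤ _ := by
              gcongr
              rw [eab, div_mul_eq_mul_div, ← mul_assoc, mul_comm (60 * t ^ 2),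
                mul_assoc (((n : ℝ) + 2) ^ 2), mul_div_cancel_left₀ _ (by positivity)]
              linarith
      refine (Finset.sum_le_sum key).trans ?_
      rw [← Finset.mul_sum]
      gcongr
      rw [Finset.sum_add_distrib, Finset.sum_sub_distrib, Finset.sum_add_distrib, ← Finset.mul_sum,
        sum_quicksortToll, ← Finset.mul_sum, sum_mul_reflect]
      -- The mean of `a (1 - a)` is `(n + 3) / (6 (n + 2))`, slightly above `1 / 6`.
      have : 10 * t ^ 2 * ((n : ℝ) + 1) ≤
          60 * t ^ 2 / ((n : ℝ) + 2) ^ 2 * (((n : ℝ) + 1) * (n + 2) * (n + 3) / 6) := by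
        have e : 60 * t ^ 2 / ((n : ℝ) + 2) ^ 2 * (((n : ℝ) + 1) * (n + 2) * (n + 3) / 6) =
            10 * t ^ 2 * ((n : ℝ) + 1) * (((n : ℝ) + 3) / (n + 2)) := by
          field_simp
          ring
        rw [e]
        refine le_mul_of_one_le_right (by positivity) ?_
        rw [one_le_div hn2]
        linarith
      simp
      linarith

theorem quicksortAvg_normalize (n : ℕ) : quicksortAvg n (quicksortNormalize n) = 0 := by
  have : quicksortNormalize n = fun c : ℕ => ((c : ℝ) + -quicksortMean n) * ((n : ℝ) + 1)⁻¹ := by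
    ext c; rw [quicksortNormalize, div_eq_mul_inv, sub_eq_add_neg]
  rw [this, quicksortAvg_mul_right, quicksortAvg_add, quicksortAvg_const, ← quicksortMean_eq_avg]
  simp

/-- All absolute moments of `Z_n` are bounded uniformly in `n`. -/
theorem exists_moment_bound (s : ℕ) :
    ∃ C : ℝ, 0 ≤ C ∧ ∀ n, quicksortAvg n (fun c => |quicksortNormalize n c| ^ s) ≤ C := by
  -- From `|z| ^ s ≤ 15 ^ s s! exp(|z| / 15)`, with the exponential of `|z| / 15` bounded by the sum
  -- of those of `± z / 15`; each has mean at most `exp(30 / 225) ≤ e`.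
  refine ⟨15 ^ s * s.factorial * (Real.exp 1 + Real.exp 1), by positivity, fun n => ?_⟩
  have h : ∀ t : ℝ, |t| = 1 / 15 → quicksortTransform Real.exp n t ≤ Real.exp 1 := by
    intro t ht
    refine (exp_transform_le n t ht.le).trans (Real.exp_le_exp.2 ?_)
    rw [← sq_abs, ht]; norm_num
  have hb : ∀ c, |quicksortNormalize n c| ^ s ≤ 15 ^ s * s.factorial *
      (Real.exp (1 / 15 * quicksortNormalize n c) +
        Real.exp (-(1 / 15) * quicksortNormalize n c)) := by
    intro c
    set z := quicksortNormalize n c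
    have h1 := Real.pow_div_factorial_le_exp (1 / 15 * |z|) (by positivity) s
    have h2 : Real.exp (1 / 15 * |z|) ≤ Real.exp (1 / 15 * z) + Real.exp (-(1 / 15) * z) := by
      rcases abs_cases z with ⟨h, -⟩ | ⟨h, -⟩ <;> rw [h]
      · linarith [Real.exp_pos (-(1 / 15) * z)]
      · rw [mul_neg, neg_mul]
        linarith [Real.exp_pos (1 / 15 * z)]
    have h3 : (0 : ℝ) < s.factorial := by exact_mod_cast s.factorial_pos
    rw [div_le_iff₀ h3] at h1
    calc |z| ^ s = 15 ^ s * (1 / 15 * |z|) ^ s := by rw [← mul_pow]; congr 1; ring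
      _ ≤ 15 ^ s * (Real.exp (1 / 15 * |z|) * s.factorial) := by gcongr
      _ = 15 ^ s * s.factorial * Real.exp (1 / 15 * |z|) := by ring
      _ ≤ _ := by gcongr
  refine (quicksortAvg_mono n hb).trans ?_
  rw [quicksortAvg_mul_left, quicksortAvg_add]
  have e1 := h (1 / 15) (by norm_num [abs_of_pos])
  have e2 := h (-(1 / 15)) (by norm_num [abs_of_pos])
  simp only [quicksortTransform] at e1 e2
  gcongr

/-! ### Characteristic functions of the normalized laws. -/

theorem integral_quicksortZLaw {E : Type*} [RCLike E] (n : ℕ) {f : ℝ → E}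
    (hf : StronglyMeasurable f) :
    ∫ z, f z ∂(quicksortZLaw n : Measure ℝ) =
      quicksortAvg n (fun c => f (quicksortNormalize n c)) := by
  let _ : MeasurableSpace (Equiv.Perm (Fin n)) := ⊤
  have hm : Measurable (quicksortZ n) := measurable_from_top
  have h : (quicksortZLaw n : Measure ℝ) =
      (PMF.uniformOfFintype (Equiv.Perm (Fin n))).toMeasure.map (quicksortZ n) :=
    (PMF.toMeasure_map _ _ hm).symm
  rw [h, integral_map hm.aemeasurable hf.aestronglyMeasurable, PMF.integral_eq_sum, quicksortAvg,
    Finset.sum_div]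
  refine Finset.sum_congr rfl fun σ _ => ?_
  rw [PMF.uniformOfFintype_apply, Fintype.card_perm, Fintype.card_fin, ENNReal.toReal_inv,
    ENNReal.toReal_natCast, RCLike.real_smul_eq_coe_mul, div_eq_inv_mul]
  simp [quicksortZ, quicksortNormalize]

/-- The characteristic function of `Z_n`. -/
noncomputable def quicksortCharFun (n : ℕ) (t : ℝ) : ℂ :=
  quicksortTransform (fun x : ℝ => Complex.exp (x * Complex.I)) n t

theorem charFun_quicksortZLaw (n : ℕ) (t : ℝ) :
    charFun (quicksortZLaw n : Measure ℝ) t = quicksortCharFun n t := by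
  rw [charFun_apply_real, integral_quicksortZLaw n (f := fun z : ℝ => Complex.exp (t * z * Complex.I))
    (Continuous.stronglyMeasurable (by fun_prop))]
  simp [quicksortCharFun, quicksortTransform]

theorem norm_exp_sub_exp_le (x y : ℝ) :
    ‖Complex.exp (x * Complex.I) - Complex.exp (y * Complex.I)‖ ≤ |x - y| := by
  have h : Complex.exp (x * Complex.I) - Complex.exp (y * Complex.I) =
      Complex.exp (y * Complex.I) * (Complex.exp (Complex.I * ((x - y : ℝ) : ℂ)) - 1) := by
    rw [mul_sub, mul_one, ← Complex.exp_add]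
    congr 2
    push_cast
    ring
  rw [h, norm_mul, Complex.norm_exp_ofReal_mul_I, one_mul]
  exact Real.norm_exp_I_mul_ofReal_sub_one_le

theorem norm_exp_sub_one_sub_le (x : ℝ) :
    ‖Complex.exp (x * Complex.I) - 1 - x * Complex.I‖ ≤ 3 * x ^ 2 := by
  have hn : ‖(x : ℂ) * Complex.I‖ = |x| := by simp
  rcases le_or_gt |x| 1 with h | h
  · have := Complex.norm_exp_sub_one_sub_id_le (x := x * Complex.I) (by rw [hn]; exact h)
    rw [hn, sq_abs] at this
    nlinarith [sq_nonneg x]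
  · have h1 := norm_sub_le (Complex.exp (x * Complex.I) - 1) (x * Complex.I)
    have h2 := norm_exp_sub_exp_le x 0
    simp only [Complex.ofReal_zero, zero_mul, Complex.exp_zero, sub_zero] at h2
    rw [hn] at h1
    rw [← sq_abs]
    nlinarith

theorem norm_quicksortCharFun_le (n : ℕ) (t : ℝ) : ‖quicksortCharFun n t‖ ≤ 1 := by
  refine (norm_quicksortAvg_le n _).trans ?_
  simp only [Complex.norm_exp_ofReal_mul_I]
  rw [quicksortAvg_const]

theorem exists_charFun_lipschitz :
    ∃ C : ℝ, 0 ≤ C ∧ ∀ n s t, ‖quicksortCharFun n s - quicksortCharFun n t‖ ≤ C * |s - t| := by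
  obtain ⟨C, hC, h⟩ := exists_moment_bound 1
  refine ⟨C, hC, fun n s t => ?_⟩
  have e : quicksortCharFun n s - quicksortCharFun n t = quicksortAvg n (fun c =>
      Complex.exp ((s * quicksortNormalize n c : ℝ) * Complex.I) +
        (-1) * Complex.exp ((t * quicksortNormalize n c : ℝ) * Complex.I)) := by
    rw [quicksortAvg_add, quicksortAvg_mul_left]
    simp [quicksortCharFun, quicksortTransform, sub_eq_add_neg]
  rw [e]
  refine (norm_quicksortAvg_le n _).trans ?_
  have := quicksortAvg_mono n (f := fun c =>
    ‖Complex.exp ((s * quicksortNormalize n c : ℝ) * Complex.I) +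
        (-1) * Complex.exp ((t * quicksortNormalize n c : ℝ) * Complex.I)‖)
    (g := fun c => |quicksortNormalize n c| ^ 1 * |s - t|) (fun c => by
      rw [neg_one_mul, ← sub_eq_add_neg]
      refine (norm_exp_sub_exp_le _ _).trans ?_
      rw [← sub_mul, abs_mul, mul_comm, pow_one])
  refine this.trans ?_
  rw [quicksortAvg_mul_right]
  exact mul_le_mul_of_nonneg_right (h n) (abs_nonneg _)

/-- The linear term vanishes because `Z_n` is centered. The quadratic order is essential: a linear
bound would pass through the recursion with factor `u + (1 - u) = 1`, without contraction. -/
theorem exists_charFun_sub_one_bound :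
    ∃ C : ℝ, 0 ≤ C ∧ ∀ n t, ‖quicksortCharFun n t - 1‖ ≤ C * t ^ 2 := by
  obtain ⟨C, hC, h⟩ := exists_moment_bound 2
  refine ⟨3 * C, by positivity, fun n t => ?_⟩
  have h0 : quicksortAvg n (fun c => (quicksortNormalize n c : ℂ)) = 0 := by
    have := congrArg (fun x : ℝ => (x : ℂ)) (quicksortAvg_normalize n)
    simpa [quicksortAvg] using this
  have e : quicksortCharFun n t - 1 = quicksortAvg n (fun c =>
      Complex.exp ((t * quicksortNormalize n c : ℝ) * Complex.I) +
        (-1 + (-t * Complex.I) * quicksortNormalize n c)) := by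
    rw [quicksortAvg_add, quicksortAvg_add, quicksortAvg_mul_left, h0, quicksortAvg_const]
    simp [quicksortCharFun, quicksortTransform, sub_eq_add_neg]
  rw [e]
  refine (norm_quicksortAvg_le n _).trans ?_
  refine (quicksortAvg_mono n (g := fun c => |quicksortNormalize n c| ^ 2 * (3 * t ^ 2))
    (fun c => ?_)).trans ?_
  · refine (le_of_eq ?_).trans ((norm_exp_sub_one_sub_le (t * quicksortNormalize n c)).trans
      (le_of_eq ?_))
    · congr 1
      push_cast
      ring
    · rw [sq_abs]; ring
  · rw [quicksortAvg_mul_right]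
    have := mul_le_mul_of_nonneg_right (h n) (show (0 : ℝ) ≤ 3 * t ^ 2 by positivity)
    linarith

/-! ### Asymptotics of the pivot rank and of the toll. -/

/-- The limiting toll function. -/
noncomputable def limitToll (u : ℝ) : ℝ :=
  1 + 2 * (u * Real.log u) + 2 * ((1 - u) * Real.log (1 - u))

/-- Both harmonic numbers are a logarithm plus Euler's constant up to `o(1)`; the constants cancel.
-/
theorem tendsto_harmonic_sub {k : ℕ → ℕ} {v : ℝ} (hv : 0 < v)
    (h : Tendsto (fun n => (k n : ℝ) / (n + 1)) atTop (𝓝 v)) :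
    Tendsto k atTop atTop ∧
    Tendsto (fun n => (harmonic (n + 1) : ℝ) - harmonic (k n)) atTop (𝓝 (-Real.log v)) := by
  have hn : Tendsto (fun n : ℕ => (n : ℝ) + 1) atTop atTop :=
    tendsto_atTop_add_const_right _ _ tendsto_natCast_atTop_atTop
  have hk : Tendsto k atTop atTop := by
    rw [← tendsto_natCast_atTop_iff (R := ℝ)]
    refine (h.pos_mul_atTop hv hn).congr fun n => ?_
    field_simp
  refine ⟨hk, ?_⟩
  have h1 := Real.tendsto_harmonic_sub_log.comp (tendsto_add_atTop_nat 1)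
  have h2 := Real.tendsto_harmonic_sub_log.comp hk
  have h3 := (h.log hv.ne')
  have h4 := (h1.sub h2).sub h3
  simp only [sub_self, zero_sub] at h4
  refine h4.congr' ?_
  filter_upwards [hk.eventually_gt_atTop 0] with n hn
  have : (0 : ℝ) < k n := by exact_mod_cast hn
  have h5 : (0 : ℝ) < (n : ℝ) + 1 := by positivity
  simp only [Function.comp]
  rw [Real.log_div this.ne' h5.ne']
  push_cast
  ring

/-- The rank of the pivot among `n + 1` keys, as a function of a uniform variable. -/
noncomputable def pivotRank (n : ℕ) (u : ℝ) : ℕ := ⌊((n + 1 : ℕ) : ℝ) * u⌋₊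

theorem pivotRank_le {n : ℕ} {u : ℝ} (h0 : 0 < u) (h1 : u < 1) : pivotRank n u ≤ n := by
  rw [pivotRank, ← Nat.lt_succ_iff, Nat.floor_lt (by positivity)]
  exact mul_lt_of_lt_one_right (by positivity) h1

theorem tendsto_pivotRank_div {u : ℝ} (h0 : 0 < u) :
    Tendsto (fun n => (pivotRank n u : ℝ) / (n + 1)) atTop (𝓝 u) := by
  have hn : Tendsto (fun n : ℕ => (n : ℝ) + 1) atTop atTop :=
    tendsto_atTop_add_const_right _ _ tendsto_natCast_atTop_atTop
  have := (tendsto_nat_floor_mul_div_atTop h0.le).comp hn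
  refine this.congr fun n => ?_
  simp [pivotRank, mul_comm]

theorem tendsto_sub_pivotRank_div {u : ℝ} (h0 : 0 < u) (h1 : u < 1) :
    Tendsto (fun n => ((n - pivotRank n u : ℕ) : ℝ) / (n + 1)) atTop (𝓝 (1 - u)) := by
  have h := ((tendsto_pivotRank_div h0).const_sub 1).sub
    (tendsto_one_div_add_atTop_nhds_zero_nat (𝕜 := ℝ))
  rw [sub_zero] at h
  refine h.congr fun n => ?_
  rw [Nat.cast_sub (pivotRank_le h0 h1)]
  have : (n : ℝ) + 1 ≠ 0 := by positivity
  field_simp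
  ring

theorem tendsto_pivotRank_weight {u : ℝ} (h0 : 0 < u) :
    Tendsto (fun n => ((pivotRank n u : ℝ) + 1) / (n + 2)) atTop (𝓝 u) := by
  have h3 : Tendsto (fun n : ℕ => ((n : ℝ) + 1) / (n + 2)) atTop (𝓝 1) := by
    have := (tendsto_one_div_add_atTop_nhds_zero_nat (𝕜 := ℝ)).comp (tendsto_add_atTop_nat 1)
    have := this.const_sub 1
    rw [sub_zero] at this
    refine this.congr fun n => ?_
    simp only [Function.comp]
    push_cast
    have : (n : ℝ) + 2 ≠ 0 := by positivity
    have : (n : ℝ) + 1 + 1 ≠ 0 := by positivity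
    field_simp
    ring
  have h := ((tendsto_pivotRank_div h0).add
    (tendsto_one_div_add_atTop_nhds_zero_nat (𝕜 := ℝ))).mul h3
  rw [add_zero, mul_one] at h
  refine h.congr fun n => ?_
  have : (n : ℝ) + 1 ≠ 0 := by positivity
  have : (n : ℝ) + 2 ≠ 0 := by positivity
  field_simp

theorem tendsto_quicksortToll {u : ℝ} (h0 : 0 < u) (h1 : u < 1) :
    Tendsto (fun n => quicksortToll n (pivotRank n u)) atTop (𝓝 (limitToll u)) := by
  have ha := tendsto_pivotRank_weight h0
  have e1 := (tendsto_harmonic_sub h0 (tendsto_pivotRank_div h0)).2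
  have e2 := (tendsto_harmonic_sub (sub_pos.2 h1) (tendsto_sub_pivotRank_div h0 h1)).2
  have h3 : Tendsto (fun n : ℕ => ((n : ℝ) + 4) / (n + 2)) atTop (𝓝 1) := by
    have := (tendsto_one_div_add_atTop_nhds_zero_nat (𝕜 := ℝ)).comp (tendsto_add_atTop_nat 1)
    have := (this.const_mul 2).const_add 1
    rw [mul_zero, add_zero] at this
    refine this.congr fun n => ?_
    simp only [Function.comp]
    push_cast
    have : (n : ℝ) + 2 ≠ 0 := by positivity
    have : (n : ℝ) + 1 + 1 ≠ 0 := by positivity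
    field_simp
    ring
  have h := (h3.sub ((ha.mul e1).const_mul 2)).sub (((ha.const_sub 1).mul e2).const_mul 2)
  have e : limitToll u = 1 - 2 * (u * -Real.log u) - 2 * ((1 - u) * -Real.log (1 - u)) := by
    rw [limitToll]; ring
  rw [e]
  refine h.congr fun n => ?_
  rw [quicksortToll_eq (pivotRank_le h0 h1)]
  have : (n : ℝ) + 2 ≠ 0 := by positivity
  field_simp
  ring

/-! ### Contraction and convergence of the characteristic functions. -/

/-- Realizing the pivot ranks of all sizes through one uniform variable `u` lets recursions with
different `n` be compared pointwise in `u`. -/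
theorem sum_div_eq_integral_floor (F : ℕ → ℂ) (n : ℕ) :
    (∑ i ∈ Finset.range (n + 1), F i) / ((n : ℂ) + 1) =
      ∫ u in Set.Ioo (0 : ℝ) 1, F (pivotRank n u) := by
  have hstep : ∀ i : ℕ, Set.EqOn (fun v : ℝ => F ⌊v⌋₊) (fun _ => F i)
      (Set.Ioo (i : ℝ) ((i + 1 : ℕ) : ℝ)) := by
    intro i v hv
    have : ⌊v⌋₊ = i := by
      rw [Nat.floor_eq_iff ((Nat.cast_nonneg i).trans hv.1.le)]
      exact ⟨hv.1.le, by exact_mod_cast hv.2⟩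
    simp only [this]
  have hle : ∀ i : ℕ, (i : ℝ) ≤ ((i + 1 : ℕ) : ℝ) := fun i => by push_cast; linarith
  have hint : ∀ i : ℕ, IntervalIntegrable (fun v : ℝ => F ⌊v⌋₊) volume i ((i + 1 : ℕ) : ℝ) := by
    intro i
    rw [intervalIntegrable_iff_integrableOn_Ioo_of_le (hle i)]
    exact (integrableOn_congr_fun (hstep i) measurableSet_Ioo).2 (by simp)
  have hval : ∀ i : ℕ, ∫ v in (i : ℝ)..((i + 1 : ℕ) : ℝ), F ⌊v⌋₊ = F i := by
    intro i
    rw [intervalIntegral.integral_of_le (hle i), integral_Ioc_eq_integral_Ioo,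
      setIntegral_congr_fun measurableSet_Ioo (hstep i)]
    simp
  have hsum := intervalIntegral.sum_integral_adjacent_intervals (n := n + 1)
    (a := fun i : ℕ => (i : ℝ)) (fun i _ => hint i)
  simp only [hval] at hsum
  rw [← integral_Ioc_eq_integral_Ioo, ← intervalIntegral.integral_of_le zero_le_one]
  simp only [pivotRank]
  rw [intervalIntegral.integral_comp_mul_left (fun v => F ⌊v⌋₊) (by positivity : ((n + 1 : ℕ) : ℝ) ≠ 0),
    mul_zero, mul_one, hsum]
  simp [div_eq_inv_mul]

/-- The integrand of the recursion for the characteristic functions. -/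
noncomputable def charFunIntegrand (n : ℕ) (t : ℝ) (i : ℕ) : ℂ :=
  quicksortCharFun i (((i : ℝ) + 1) / (n + 2) * t) *
    quicksortCharFun (n - i) ((1 - ((i : ℝ) + 1) / (n + 2)) * t) *
    Complex.exp ((t * quicksortToll n i : ℝ) * Complex.I)

theorem quicksortCharFun_succ (n : ℕ) (t : ℝ) : quicksortCharFun (n + 1) t =
    ∫ u in Set.Ioo (0 : ℝ) 1, charFunIntegrand n t (pivotRank n u) := by
  rw [← sum_div_eq_integral_floor, quicksortCharFun, quicksortTransform_succ]
  · rfl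
  · intro x y
    rw [← Complex.exp_add]
    congr 1
    push_cast
    ring

theorem measurable_comp_pivotRank {E : Type*} [MeasurableSpace E] (F : ℕ → E) (n : ℕ) :
    Measurable fun u => F (pivotRank n u) := by
  have : Measurable F := measurable_from_nat
  exact this.comp (Nat.measurable_floor.comp (measurable_const_mul _))

theorem norm_charFunIntegrand_le (n : ℕ) (t : ℝ) (i : ℕ) : ‖charFunIntegrand n t i‖ ≤ 1 := by
  rw [charFunIntegrand, norm_mul, norm_mul, Complex.norm_exp_ofReal_mul_I, mul_one]
  exact mul_le_one₀ (norm_quicksortCharFun_le _ _) (norm_nonneg _) (norm_quicksortCharFun_le _ _)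

theorem norm_mul_mul_sub_le {a b c a' b' c' : ℂ} (hb : ‖b‖ ≤ 1) (hc : ‖c‖ ≤ 1)
    (ha' : ‖a'‖ ≤ 1) (hb' : ‖b'‖ ≤ 1) :
    ‖a * b * c - a' * b' * c'‖ ≤ ‖a - a'‖ + ‖b - b'‖ + ‖c - c'‖ := by
  have e : a * b * c - a' * b' * c' = (a - a') * (b * c) + (b - b') * (a' * c) +
      (c - c') * (a' * b') := by ring
  rw [e]
  refine (norm_add₃_le).trans ?_
  have h : ∀ w x y : ℂ, ‖x‖ ≤ 1 → ‖y‖ ≤ 1 → ‖w * (x * y)‖ ≤ ‖w‖ := fun w x y hx hy => by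
    rw [norm_mul, norm_mul]
    exact mul_le_of_le_one_right (norm_nonneg _) (mul_le_one₀ hx (norm_nonneg _) hy)
  exact add_le_add (add_le_add (h _ _ _ hb hc) (h _ _ _ ha' hc)) (h _ _ _ ha' hb')

theorem tendsto_charFun_shift {k : ℕ → ℕ} {s : ℕ → ℝ} {s₀ : ℝ}
    (hs : Tendsto s atTop (𝓝 s₀)) :
    Tendsto (fun n => quicksortCharFun (k n) (s n) - quicksortCharFun (k n) s₀) atTop (𝓝 0) := by
  obtain ⟨C, -, h⟩ := exists_charFun_lipschitz
  refine squeeze_zero_norm (fun n => h (k n) (s n) s₀) ?_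
  have := ((hs.sub_const s₀).abs).const_mul C
  simpa using this

theorem integral_sq_add_sq_sub (M : ℝ) :
    ∫ u in Set.Ioo (0 : ℝ) 1, M * (u ^ 2 + (1 - u) ^ 2) = 2 / 3 * M := by
  rw [← integral_Ioc_eq_integral_Ioo, ← intervalIntegral.integral_of_le zero_le_one]
  have : ∀ u : ℝ, M * (u ^ 2 + (1 - u) ^ 2) = M * (2 * u ^ 2 - 2 * u + 1) := fun u => by ring
  simp only [this]
  rw [intervalIntegral.integral_const_mul, intervalIntegral.integral_add, intervalIntegral.integral_sub,
    intervalIntegral.integral_const_mul, intervalIntegral.integral_const_mul]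
  · norm_num [integral_pow]
    ring
  all_goals exact Continuous.intervalIntegrable (by fun_prop) _ _

/-- The contraction step: a quadratic bound on the asymptotic oscillation of the characteristic
functions improves by the factor `2 / 3`. -/
theorem charFun_oscillation_step {M : ℝ} (hM : 0 ≤ M)
    (h : ∀ t ε : ℝ, 0 < ε → ∀ᶠ p : ℕ × ℕ in atTop,
      ‖quicksortCharFun p.1 t - quicksortCharFun p.2 t‖ ≤ M * t ^ 2 + ε) :
    ∀ t ε : ℝ, 0 < ε → ∀ᶠ p : ℕ × ℕ in atTop,
      ‖quicksortCharFun p.1 t - quicksortCharFun p.2 t‖ ≤ 2 / 3 * M * t ^ 2 + ε := by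
  intro t ε hε
  set B : ℝ → ℝ := fun u => M * t ^ 2 * (u ^ 2 + (1 - u) ^ 2) with hB
  set F : ℕ × ℕ → ℝ → ℝ := fun p u =>
    ‖charFunIntegrand p.1 t (pivotRank p.1 u) - charFunIntegrand p.2 t (pivotRank p.2 u)‖ with hF
  have hBc : Continuous B := by fun_prop
  have hFm : ∀ p, Measurable (F p) := fun p =>
    ((measurable_comp_pivotRank _ _).sub (measurable_comp_pivotRank _ _)).norm
  have hF2 : ∀ p u, F p u ≤ 2 := fun p u => by
    refine (norm_sub_le _ _).trans ?_
    linarith [norm_charFunIntegrand_le p.1 t (pivotRank p.1 u),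
      norm_charFunIntegrand_le p.2 t (pivotRank p.2 u)]
  have hB0 : ∀ u, 0 ≤ B u := fun u => by positivity
  have hBi : IntegrableOn B (Set.Ioo 0 1) :=
    (hBc.integrableOn_Icc (a := 0) (b := 1)).mono_set Set.Ioo_subset_Icc_self
  -- `F p u` need not be known to converge; only its upper limit is bounded, by `B u`. Its maximum
  -- with `B u` does converge, so dominated convergence applies.
  have hlim : Tendsto (fun p : ℕ × ℕ => ∫ u in Set.Ioo (0 : ℝ) 1, max (F p u) (B u)) atTop
      (𝓝 (∫ u in Set.Ioo (0 : ℝ) 1, B u)) := by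
    refine tendsto_integral_filter_of_dominated_convergence (fun u => 2 + B u) ?_ ?_ ?_ ?_
    · exact Eventually.of_forall fun p => ((hFm p).max hBc.measurable).aestronglyMeasurable
    · refine Eventually.of_forall fun p => Eventually.of_forall fun u => ?_
      rw [Real.norm_eq_abs, abs_of_nonneg (le_max_of_le_right (hB0 u))]
      exact max_le (by linarith [hF2 p u, hB0 u]) (by linarith)
    · exact (integrable_const _).add hBi
    · refine (ae_restrict_iff' measurableSet_Ioo).2 (Eventually.of_forall fun u hu => ?_)
      have hr := tendsto_sub_pivotRank_div hu.1 hu.2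
      have hi1 := (tendsto_harmonic_sub hu.1 (tendsto_pivotRank_div hu.1)).1
      have hi2 := (tendsto_harmonic_sub (sub_pos.2 hu.2) hr).1
      have hw := tendsto_pivotRank_weight hu.1
      have hs1 := tendsto_charFun_shift (k := fun n => pivotRank n u) (hw.mul_const t)
      have hs2 := tendsto_charFun_shift (k := fun n => n - pivotRank n u)
        ((hw.const_sub 1).mul_const t)
      have hg : Tendsto (fun n => t * quicksortToll n (pivotRank n u)) atTop
          (𝓝 (t * limitToll u)) := (tendsto_quicksortToll hu.1 hu.2).const_mul t
      rw [Metric.tendsto_nhds]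
      intro δ hδ
      -- Eight errors occur: three for each characteristic function factor and two for the toll.
      -- Together they cost `δ / 2`.
      have hδ' : 0 < δ / 16 := by positivity
      have small : ∀ {f : ℕ → ℂ}, Tendsto f atTop (𝓝 0) → ∀ᶠ n in atTop, ‖f n‖ < δ / 16 :=
        fun hf => by simpa using (Metric.tendsto_nhds.1 hf) (δ / 16) hδ'
      have hg' : ∀ᶠ n in atTop, |t * quicksortToll n (pivotRank n u) - t * limitToll u| < δ / 16 :=
        by simpa [Real.dist_eq] using (Metric.tendsto_nhds.1 hg) (δ / 16) hδ'
      have hT1 : Tendsto (fun p : ℕ × ℕ => p.1) atTop atTop := by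
        rw [← prod_atTop_atTop_eq]; exact tendsto_fst
      have hT2 : Tendsto (fun p : ℕ × ℕ => p.2) atTop atTop := by
        rw [← prod_atTop_atTop_eq]; exact tendsto_snd
      have hpair : ∀ {k : ℕ → ℕ}, Tendsto k atTop atTop →
          Tendsto (fun p : ℕ × ℕ => (k p.1, k p.2)) atTop atTop := fun hk => by
        have := (hk.comp hT1).prodMk (hk.comp hT2)
        rwa [prod_atTop_atTop_eq] at this
      filter_upwards [hT1.eventually (small hs1), hT2.eventually (small hs1),
        hT1.eventually (small hs2), hT2.eventually (small hs2), hT1.eventually hg',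
        hT2.eventually hg', (hpair hi1).eventually (h (u * t) (δ / 16) hδ'),
        (hpair hi2).eventually (h ((1 - u) * t) (δ / 16) hδ')] with p a1 a2 b1 b2 c1 c2 d1 d2
      have hFB : F p u ≤ B u + δ / 2 := by
        refine (norm_mul_mul_sub_le (norm_quicksortCharFun_le _ _) ?_ (norm_quicksortCharFun_le _ _)
          (norm_quicksortCharFun_le _ _)).trans ?_
        · rw [Complex.norm_exp_ofReal_mul_I]
        have e3 := norm_exp_sub_exp_le (t * quicksortToll p.1 (pivotRank p.1 u))
          (t * quicksortToll p.2 (pivotRank p.2 u))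
        have e3' := abs_sub_le (t * quicksortToll p.1 (pivotRank p.1 u)) (t * limitToll u)
          (t * quicksortToll p.2 (pivotRank p.2 u))
        rw [abs_sub_comm (t * limitToll u)] at e3'
        have tri : ∀ x y x' y' : ℂ, ‖x - y‖ ≤ ‖x - x'‖ + ‖y - y'‖ + ‖x' - y'‖ := fun x y x' y' => by
          have : x - y = (x - x') - (y - y') + (x' - y') := by ring
          rw [this]
          exact (norm_add_le _ _).trans (add_le_add_left (norm_sub_le _ _) _)
        have e1 := tri (quicksortCharFun (pivotRank p.1 u) (((pivotRank p.1 u : ℝ) + 1) / (p.1 + 2) * t))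
          (quicksortCharFun (pivotRank p.2 u) (((pivotRank p.2 u : ℝ) + 1) / (p.2 + 2) * t))
          (quicksortCharFun (pivotRank p.1 u) (u * t)) (quicksortCharFun (pivotRank p.2 u) (u * t))
        have e2 := tri (quicksortCharFun (p.1 - pivotRank p.1 u)
            ((1 - ((pivotRank p.1 u : ℝ) + 1) / (p.1 + 2)) * t))
          (quicksortCharFun (p.2 - pivotRank p.2 u)
            ((1 - ((pivotRank p.2 u : ℝ) + 1) / (p.2 + 2)) * t))
          (quicksortCharFun (p.1 - pivotRank p.1 u) ((1 - u) * t))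
          (quicksortCharFun (p.2 - pivotRank p.2 u) ((1 - u) * t))
        have eB : B u = M * (u * t) ^ 2 + M * ((1 - u) * t) ^ 2 := by
          simp only [hB]; ring
        rw [eB]
        linarith
      rw [Real.dist_eq, abs_of_nonneg (sub_nonneg.2 (le_max_right _ _)), sub_lt_iff_lt_add]
      exact max_lt (by linarith) (by linarith)
  rw [show (∫ u in Set.Ioo (0 : ℝ) 1, B u) = 2 / 3 * M * t ^ 2 by
    simp only [hB]; rw [integral_sq_add_sq_sub]; ring] at hlim
  have hfin := hlim.eventually_lt_const (show 2 / 3 * M * t ^ 2 < 2 / 3 * M * t ^ 2 + ε by linarith)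
  have hshift : ∀ᶠ p : ℕ × ℕ in atTop,
      ‖quicksortCharFun (p.1 + 1) t - quicksortCharFun (p.2 + 1) t‖ ≤ 2 / 3 * M * t ^ 2 + ε := by
    filter_upwards [hfin] with p hp
    have hint : ∀ n, IntegrableOn (fun u => charFunIntegrand n t (pivotRank n u))
        (Set.Ioo (0 : ℝ) 1) := fun n =>
      Integrable.of_bound (measurable_comp_pivotRank _ _).aestronglyMeasurable 1
        (Eventually.of_forall fun u => norm_charFunIntegrand_le _ _ _)
    rw [quicksortCharFun_succ, quicksortCharFun_succ, ← integral_sub (hint _) (hint _)]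
    refine (norm_integral_le_integral_norm _).trans (le_trans ?_ hp.le)
    refine integral_mono ((hint _).sub (hint _)).norm ?_ fun u => le_max_left _ _
    refine Integrable.mono' ((integrable_const (2 : ℝ)).add hBi)
      ((hFm p).max hBc.measurable).aestronglyMeasurable (Eventually.of_forall fun u => ?_)
    rw [Real.norm_eq_abs, abs_of_nonneg (le_max_of_le_right (hB0 u))]
    exact max_le (by simp; linarith [hF2 p u, hB0 u]) (by simp)
  obtain ⟨⟨N₁, N₂⟩, hN⟩ := eventually_atTop.1 hshift
  refine eventually_atTop.2 ⟨(N₁ + 1, N₂ + 1), fun p hp => ?_⟩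
  obtain ⟨h1, h2⟩ := Prod.le_def.1 hp
  simp only at h1 h2
  have := hN (p.1 - 1, p.2 - 1) (Prod.le_def.2 ⟨by simp only; omega, by simp only; omega⟩)
  simpa only [Nat.sub_add_cancel (show 1 ≤ p.1 by omega), Nat.sub_add_cancel (show 1 ≤ p.2 by omega)]
    using this

theorem cauchySeq_quicksortCharFun (t : ℝ) : CauchySeq fun n => quicksortCharFun n t := by
  obtain ⟨C, hC, h⟩ := exists_charFun_sub_one_bound
  -- The initial constant `2 * C` comes from comparing both characteristic functions with `1`.
  have hj : ∀ j : ℕ, ∀ t ε : ℝ, 0 < ε → ∀ᶠ p : ℕ × ℕ in atTop,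
      ‖quicksortCharFun p.1 t - quicksortCharFun p.2 t‖ ≤ (2 / 3) ^ j * (2 * C) * t ^ 2 + ε := by
    intro j
    induction j with
    | zero =>
      intro t ε hε
      refine Eventually.of_forall fun p => ?_
      have := norm_sub_le (quicksortCharFun p.1 t - 1) (quicksortCharFun p.2 t - 1)
      rw [sub_sub_sub_cancel_right] at this
      linarith [h p.1 t, h p.2 t]
    | succ j ih =>
      have := charFun_oscillation_step (by positivity) ih
      simpa only [pow_succ', mul_assoc] using this
  rw [Metric.cauchySeq_iff']
  intro ε hε
  have hlim : Tendsto (fun j : ℕ => (2 / 3 : ℝ) ^ j * (2 * C) * t ^ 2) atTop (𝓝 0) := by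
    have := ((tendsto_pow_atTop_nhds_zero_of_lt_one (r := (2 / 3 : ℝ)) (by norm_num)
      (by norm_num)).mul_const (2 * C)).mul_const (t ^ 2)
    simpa using this
  obtain ⟨j, hj'⟩ := (hlim.eventually_lt_const (show 0 < ε / 2 by positivity)).exists
  obtain ⟨⟨N₁, N₂⟩, hN⟩ := eventually_atTop.1 (hj j t (ε / 4) (by positivity))
  refine ⟨max N₁ N₂, fun n hn => ?_⟩
  rw [dist_eq_norm]
  have := hN (n, max N₁ N₂) (Prod.le_def.2 ⟨(le_max_left _ _).trans hn, le_max_right _ _⟩)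
  simp only at this
  linarith

/-- The uniform Lipschitz bound makes the pointwise limit `φ` continuous, hence the laws are tight.
A subsequential limit exists by compactness and has characteristic function `φ`, so the whole
sequence converges to it. -/
theorem exists_quicksortLimitLaw : ∃ μ : ProbabilityMeasure ℝ, IsQuicksortLimitLaw μ := by
  choose φ hφ using fun t => cauchySeq_tendsto_of_complete (cauchySeq_quicksortCharFun t)
  have hφ' : ∀ t, Tendsto (fun n => charFun (quicksortZLaw n : Measure ℝ) t) atTop (𝓝 (φ t)) := by
    simpa only [charFun_quicksortZLaw] using hφ
  have hcont : Continuous φ := by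
    obtain ⟨C, hC, h⟩ := exists_charFun_lipschitz
    refine (LipschitzWith.of_dist_le_mul (K := ⟨C, hC⟩) fun s t => ?_).continuous
    rw [dist_eq_norm, Real.dist_eq]
    exact le_of_tendsto ((hφ s).sub (hφ t)).norm (Eventually.of_forall fun n => h n s t)
  have htight := isTightMeasureSet_of_tendsto_charFun hcont.continuousAt hφ'
  have hcomp : IsCompact (closure (Set.range quicksortZLaw)) := by
    refine isCompact_closure_of_isTightMeasureSet ?_
    convert htight using 1
    ext ν
    simp
  obtain ⟨μ, -, k, hk, hμ⟩ := hcomp.tendsto_subseq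
    (fun n => subset_closure (Set.mem_range_self (f := quicksortZLaw) n))
  refine ⟨μ, ProbabilityMeasure.tendsto_of_tendsto_charFun fun t => ?_⟩
  have h1 := (ProbabilityMeasure.tendsto_iff_tendsto_charFun.1 hμ) t
  rw [tendsto_nhds_unique h1 ((hφ' t).comp hk.tendsto_atTop)]
  exact hφ' t

/-! ### The distributional fixed point and the moments of the limit law. -/

theorem continuous_limitToll : Continuous limitToll := by
  have h := Real.continuous_mul_log
  have h' : Continuous fun u : ℝ => (1 - u) * Real.log (1 - u) :=
    h.comp (by fun_prop : Continuous fun u : ℝ => 1 - u)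
  unfold limitToll
  fun_prop

section limit

variable {μ : ProbabilityMeasure ℝ}

theorem IsQuicksortLimitLaw.tendsto_charFun (hμ : IsQuicksortLimitLaw μ) (t : ℝ) :
    Tendsto (fun n => quicksortCharFun n t) atTop (𝓝 (charFun (μ : Measure ℝ) t)) := by
  have := ProbabilityMeasure.tendsto_iff_tendsto_charFun.1 hμ t
  simpa only [charFun_quicksortZLaw] using this

theorem IsQuicksortLimitLaw.charFun_eq (hμ : IsQuicksortLimitLaw μ) (t : ℝ) :
    charFun (μ : Measure ℝ) t = ∫ u in Set.Ioo (0 : ℝ) 1,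
      charFun (μ : Measure ℝ) (u * t) * charFun (μ : Measure ℝ) ((1 - u) * t) *
        Complex.exp ((t * limitToll u : ℝ) * Complex.I) := by
  refine tendsto_nhds_unique ((hμ.tendsto_charFun t).comp (tendsto_add_atTop_nat 1)) ?_
  simp only [Function.comp_def, quicksortCharFun_succ]
  refine tendsto_integral_of_dominated_convergence (fun _ => 1) ?_ (integrable_const _) ?_ ?_
  · exact fun n => (measurable_comp_pivotRank _ _).aestronglyMeasurable
  · exact fun n => Eventually.of_forall fun u => norm_charFunIntegrand_le _ _ _
  · refine (ae_restrict_iff' measurableSet_Ioo).2 (Eventually.of_forall fun u hu => ?_)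
    have hi1 := (tendsto_harmonic_sub hu.1 (tendsto_pivotRank_div hu.1)).1
    have hi2 := (tendsto_harmonic_sub (sub_pos.2 hu.2) (tendsto_sub_pivotRank_div hu.1 hu.2)).1
    have hw := tendsto_pivotRank_weight hu.1
    have hs1 := (tendsto_charFun_shift (k := fun n => pivotRank n u) (hw.mul_const t)).add
      ((hμ.tendsto_charFun (u * t)).comp hi1)
    have hs2 := (tendsto_charFun_shift (k := fun n => n - pivotRank n u)
      ((hw.const_sub 1).mul_const t)).add ((hμ.tendsto_charFun ((1 - u) * t)).comp hi2)
    have hg : Tendsto (fun n => Complex.exp ((t * quicksortToll n (pivotRank n u) : ℝ) *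
        Complex.I)) atTop (𝓝 (Complex.exp ((t * limitToll u : ℝ) * Complex.I))) :=
      (Continuous.tendsto (f := fun x : ℝ => Complex.exp ((x : ℂ) * Complex.I)) (by fun_prop)
        (t * limitToll u)).comp ((tendsto_quicksortToll hu.1 hu.2).const_mul t)
    simp only [zero_add, Function.comp_def, sub_add_cancel] at hs1 hs2
    exact (hs1.mul hs2).mul hg

/-- The truncations at `N` are bounded and continuous, so they inherit the uniform moment bound from
`Z_n`; monotone convergence removes the truncation. -/
theorem IsQuicksortLimitLaw.integrable_abs_pow (hμ : IsQuicksortLimitLaw μ) (s : ℕ) :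
    Integrable (fun z : ℝ => |z| ^ s) (μ : Measure ℝ) := by
  obtain ⟨C, hC, h⟩ := exists_moment_bound s
  have hbound : ∀ N : ℕ, ∫ z, min (|z| ^ s) (N : ℝ) ∂(μ : Measure ℝ) ≤ C := by
    intro N
    have hc : Continuous fun z : ℝ => min (|z| ^ s) (N : ℝ) := by fun_prop
    let f : BoundedContinuousFunction ℝ ℝ := BoundedContinuousFunction.ofNormedAddCommGroup
      (fun z : ℝ => min (|z| ^ s) (N : ℝ)) hc N (fun z => by
        rw [Real.norm_eq_abs, abs_of_nonneg (le_min (by positivity) (by positivity))]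
        exact min_le_right _ _)
    have hf := (ProbabilityMeasure.tendsto_iff_forall_integral_tendsto.1 hμ) f
    refine le_of_tendsto hf (Eventually.of_forall fun n => ?_)
    refine (integral_quicksortZLaw n hc.stronglyMeasurable).le.trans
      ((quicksortAvg_mono n fun c => min_le_left _ _).trans (h n))
  refine ⟨by fun_prop, ?_⟩
  rw [hasFiniteIntegral_iff_ofReal (Eventually.of_forall fun z => by positivity)]
  refine lt_of_le_of_lt ?_ (ENNReal.ofReal_lt_top (r := C))
  have hsup : ∀ z : ℝ, ENNReal.ofReal (|z| ^ s) =
      ⨆ N : ℕ, ENNReal.ofReal (min (|z| ^ s) (N : ℝ)) := by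
    intro z
    refine le_antisymm ?_ (iSup_le fun N => ENNReal.ofReal_le_ofReal (min_le_left _ _))
    obtain ⟨N, hN⟩ := exists_nat_ge (|z| ^ s)
    exact le_iSup_of_le N (by rw [min_eq_left hN])
  simp only [hsup]
  rw [lintegral_iSup (f := fun (N : ℕ) (z : ℝ) => ENNReal.ofReal (min (|z| ^ s) (N : ℝ)))
    (fun N => by fun_prop) (fun M N hMN z => ENNReal.ofReal_le_ofReal
    (min_le_min_left _ (by exact_mod_cast hMN)))]
  refine iSup_le fun N => ?_
  rw [← ofReal_integral_eq_lintegral_ofReal]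
  · exact ENNReal.ofReal_le_ofReal (hbound N)
  · refine Integrable.of_bound (by fun_prop) N (Eventually.of_forall fun z => ?_)
    rw [Real.norm_eq_abs, abs_of_nonneg (le_min (by positivity) (by positivity))]
    exact min_le_right _ _
  · exact Eventually.of_forall fun z => le_min (by positivity) (by positivity)

theorem IsQuicksortLimitLaw.integrable_pow (hμ : IsQuicksortLimitLaw μ) (s : ℕ) :
    Integrable (fun z : ℝ => z ^ s) (μ : Measure ℝ) := by
  refine (hμ.integrable_abs_pow s).mono' (by fun_prop) (Eventually.of_forall fun z => ?_)
  simp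

/-- The bound `C t ^ 2` survives in the limit and kills the derivative at zero. This is needed
separately: for `s = 1` the first moment has coefficient `1` on both sides of the moment recursion.
-/
theorem IsQuicksortLimitLaw.integral_id (hμ : IsQuicksortLimitLaw μ) :
    ∫ z, z ∂(μ : Measure ℝ) = 0 := by
  have hLp : MemLp id (1 : ℕ) (μ : Measure ℝ) := by
    rw [Nat.cast_one, memLp_one_iff_integrable]
    simpa [Function.id_def] using hμ.integrable_pow 1
  have h1 := iteratedDeriv_charFun_zero hLp
  obtain ⟨C, hC, h⟩ := exists_charFun_sub_one_bound
  have hb : ∀ t, ‖charFun (μ : Measure ℝ) t - 1‖ ≤ C * t ^ 2 := fun t =>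
    le_of_tendsto ((hμ.tendsto_charFun t).sub_const 1).norm (Eventually.of_forall fun n => h n t)
  have hd : HasDerivAt (charFun (μ : Measure ℝ)) 0 0 := by
    rw [hasDerivAt_iff_isLittleO]
    simp only [sub_zero, smul_zero, charFun_zero, probReal_univ, Complex.ofReal_one]
    refine Asymptotics.IsBigO.trans_isLittleO (g := fun t : ℝ => t ^ 2)
      (Asymptotics.IsBigO.of_bound C (Eventually.of_forall fun t => ?_)) ?_
    · simpa using hb t
    · simpa using Asymptotics.isLittleO_pow_id (𝕜 := ℝ) (n := 2) (by norm_num)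
  rw [iteratedDeriv_one, hd.deriv] at h1
  simp at h1
  exact_mod_cast h1

/-- The map that expresses the limit law through a uniform variable and two independent copies. -/
noncomputable def limitMap (p : ℝ × ℝ × ℝ) : ℝ :=
  p.1 * p.2.1 + (1 - p.1) * p.2.2 + limitToll p.1

theorem continuous_limitMap : Continuous limitMap := by
  have := continuous_limitToll
  unfold limitMap
  fun_prop

/-- The integral equation says that both laws have the same characteristic function. As an identity
of laws it yields every moment by a trinomial expansion. -/
theorem IsQuicksortLimitLaw.eq_map (hμ : IsQuicksortLimitLaw μ) :
    (μ : Measure ℝ) = ((volume.restrict (Set.Ioo (0 : ℝ) 1)).prod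
      ((μ : Measure ℝ).prod (μ : Measure ℝ))).map limitMap := by
  have hm := continuous_limitMap.measurable
  have := continuous_limitMap
  refine Measure.ext_of_charFun (funext fun t => ?_)
  rw [charFun_apply_real (μ := Measure.map _ _), integral_map hm.aemeasurable
    (Continuous.aestronglyMeasurable (by fun_prop)), integral_prod, hμ.charFun_eq]
  · refine integral_congr_ae (Eventually.of_forall fun u => ?_)
    simp only
    rw [charFun_apply_real, charFun_apply_real, ← integral_prod_mul, ← integral_mul_const]
    refine integral_congr_ae (Eventually.of_forall fun p => ?_)
    simp only [limitMap]
    rw [← Complex.exp_add, ← Complex.exp_add]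
    congr 1
    push_cast
    ring
  · refine Integrable.of_bound (Continuous.aestronglyMeasurable (by fun_prop)) 1
      (Eventually.of_forall fun p => ?_)
    rw [← Complex.ofReal_mul, Complex.norm_exp_ofReal_mul_I]

theorem IsQuicksortLimitLaw.moment_recursion (hμ : IsQuicksortLimitLaw μ) (s : ℕ) :
    ∫ z, z ^ s ∂(μ : Measure ℝ) = ∑ k ∈ Finset.range (s + 1), ∑ l ∈ Finset.range (s - k + 1),
      (s.choose k * (s - k).choose l : ℝ) *
        ((∫ u in Set.Ioo (0 : ℝ) 1, u ^ k * (1 - u) ^ l * limitToll u ^ (s - k - l)) *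
        ((∫ z, z ^ k ∂(μ : Measure ℝ)) * ∫ z, z ^ l ∂(μ : Measure ℝ))) := by
  have hm := continuous_limitMap.measurable
  have hint : ∀ k l j : ℕ, Integrable (fun p : ℝ × ℝ × ℝ =>
      (p.1 ^ k * (1 - p.1) ^ l * limitToll p.1 ^ j) * (p.2.1 ^ k * p.2.2 ^ l))
      ((volume.restrict (Set.Ioo (0 : ℝ) 1)).prod ((μ : Measure ℝ).prod (μ : Measure ℝ))) := by
    intro k l j
    refine Integrable.mul_prod (f := fun u : ℝ => u ^ k * (1 - u) ^ l * limitToll u ^ j)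
      (g := fun q : ℝ × ℝ => q.1 ^ k * q.2 ^ l) ?_ ((hμ.integrable_pow k).mul_prod (hμ.integrable_pow l))
    have : Continuous fun u : ℝ => u ^ k * (1 - u) ^ l * limitToll u ^ j := by
      have := continuous_limitToll
      fun_prop
    exact (this.integrableOn_Icc (a := 0) (b := 1)).mono_set Set.Ioo_subset_Icc_self
  have hexp : ∀ p : ℝ × ℝ × ℝ, limitMap p ^ s =
      ∑ k ∈ Finset.range (s + 1), ∑ l ∈ Finset.range (s - k + 1),
        (s.choose k * (s - k).choose l : ℝ) *
          ((p.1 ^ k * (1 - p.1) ^ l * limitToll p.1 ^ (s - k - l)) * (p.2.1 ^ k * p.2.2 ^ l)) := by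
    intro p
    rw [limitMap, add_assoc, add_pow]
    refine Finset.sum_congr rfl fun k _ => ?_
    rw [add_pow, Finset.mul_sum, Finset.sum_mul]
    refine Finset.sum_congr rfl fun l _ => ?_
    rw [mul_pow, mul_pow]
    ring
  conv_lhs => rw [hμ.eq_map]
  rw [integral_map hm.aemeasurable (Continuous.aestronglyMeasurable (by fun_prop))]
  simp only [hexp]
  rw [integral_finsetSum _ fun k _ => integrable_finsetSum _ fun l _ => (hint k l _).const_mul _]
  refine Finset.sum_congr rfl fun k _ => ?_
  rw [integral_finsetSum _ fun l _ => (hint k l _).const_mul _]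
  refine Finset.sum_congr rfl fun l _ => ?_
  rw [integral_const_mul, integral_prod_mul (fun u : ℝ => u ^ k * (1 - u) ^ l *
    limitToll u ^ (s - k - l)) (fun q : ℝ × ℝ => q.1 ^ k * q.2 ^ l),
    integral_prod_mul (fun x : ℝ => x ^ k) (fun y : ℝ => y ^ l)]

/-- The moments lie in every rational subalgebra that contains the integrals in the recursion. -/
theorem IsQuicksortLimitLaw.moment_mem (hμ : IsQuicksortLimitLaw μ) (A : Subalgebra ℚ ℝ)
    (hA : ∀ k l j : ℕ,
      ∫ u in Set.Ioo (0 : ℝ) 1, u ^ k * (1 - u) ^ l * limitToll u ^ j ∈ A) (s : ℕ) :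
    ∫ z, z ^ s ∂(μ : Measure ℝ) ∈ A := by
  have hnat : ∀ n : ℕ, (n : ℝ) ∈ A := fun n => natCast_mem A n
  induction s using Nat.strong_induction_on with
  | _ s ih =>
    rcases s with _ | _ | r
    · simp [A.one_mem]
    · simp [hμ.integral_id, A.zero_mem]
    · set m : ℕ → ℝ := fun k => ∫ z, z ^ k ∂(μ : Measure ℝ) with hmdef
      set I : ℕ → ℕ → ℕ → ℝ := fun k l j =>
        ∫ u in Set.Ioo (0 : ℝ) 1, u ^ k * (1 - u) ^ l * limitToll u ^ j with hI
      set T : ℕ → ℕ → ℝ := fun k l => ((r + 2).choose k * (r + 2 - k).choose l : ℝ) *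
        (I k l (r + 2 - k - l) * (m k * m l)) with hT
      have hrec : m (r + 2) = ∑ k ∈ Finset.range (r + 2 + 1), ∑ l ∈ Finset.range (r + 2 - k + 1),
        T k l := hμ.moment_recursion (r + 2)
      have hterm : ∀ k l, k < r + 2 → l < r + 2 → T k l ∈ A :=
        fun k l hk hl => A.mul_mem (A.mul_mem (hnat _) (hnat _))
          (A.mul_mem (hA _ _ _) (A.mul_mem (ih k hk) (ih l hl)))
      have hm0 : m 0 = 1 := by simp [hmdef]
      have hI1 : I (r + 2) 0 0 = 1 / (r + 3) := by
        simp only [hI, pow_zero, mul_one]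
        rw [← integral_Ioc_eq_integral_Ioo, ← intervalIntegral.integral_of_le zero_le_one,
          integral_pow]
        push_cast
        norm_num
        ring
      have hI2 : I 0 (r + 2) 0 = 1 / (r + 3) := by
        simp only [hI, pow_zero, mul_one, one_mul]
        rw [← integral_Ioc_eq_integral_Ioo, ← intervalIntegral.integral_of_le zero_le_one,
          intervalIntegral.integral_comp_sub_left (fun u => u ^ (r + 2)) 1, integral_pow]
        push_cast
        norm_num
        ring
      set R1 := ∑ k ∈ Finset.range (r + 1), ∑ l ∈ Finset.range (r + 2 - (k + 1) + 1), T (k + 1) l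
      set R2 := ∑ l ∈ Finset.range (r + 2), T 0 l
      have h0 : ∑ l ∈ Finset.range (r + 2 - 0 + 1), T 0 l = R2 + T 0 (r + 2) :=
        Finset.sum_range_succ _ _
      rw [Finset.sum_range_succ, Finset.sum_range_succ', h0] at hrec
      have hT1 : T 0 (r + 2) = m (r + 2) / (r + 3) := by
        simp [hT, hm0, hI2, div_eq_inv_mul]
      have hT2 : ∑ l ∈ Finset.range (r + 2 - (r + 2) + 1), T (r + 2) l = m (r + 2) / (r + 3) := by
        simp [hT, hm0, hI1, div_eq_inv_mul]
      rw [hT1, hT2] at hrec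
      have hR1 : R1 ∈ A := A.sum_mem fun k hk => A.sum_mem fun l hl => by
        rw [Finset.mem_range] at hk hl
        exact hterm _ _ (by omega) (by omega)
      have hR2 : R2 ∈ A := A.sum_mem fun l hl => hterm 0 l (by omega) (Finset.mem_range.1 hl)
      have h3 : (r : ℝ) + 3 ≠ 0 := by positivity
      have h1 : (r : ℝ) + 1 ≠ 0 := by positivity
      -- With `s = r + 2`, the two terms containing the `s`-th moment leave the factor `1 - 2 / (r +
      -- 3) = (r + 1) / (r + 3)`, which is nonzero and rational.
      have : m (r + 2) = (algebraMap ℚ ℝ (((r : ℚ) + 3) / (r + 1))) * (R1 + R2) := by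
        simp
        field_simp at hrec ⊢
        linarith
      change m (r + 2) ∈ A
      rw [this]
      exact A.mul_mem (A.algebraMap_mem _) (A.add_mem hR1 hR2)

end limit

/-! ### Digamma and Hurwitz series, and their values at positive integers. -/

/-- The real numbers that are rational polynomials in the zeta values. -/
noncomputable def zetaAlgebra : Subalgebra ℚ ℝ :=
  (MvPolynomial.aeval (R := ℚ) fun k : ℕ => riemannZeta ((k : ℂ) + 2)).range.comap
    (Complex.ofRealAm.restrictScalars ℚ)

theorem mem_zetaAlgebra {x : ℝ} : x ∈ zetaAlgebra ↔ IsRationalPolynomialInZetaValues x := by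
  simp only [zetaAlgebra, Subalgebra.mem_comap, AlgHom.mem_range, IsRationalPolynomialInZetaValues]
  exact exists_congr fun P => eq_comm

/-- `∑ 1 / (x + n) ^ m`, the Hurwitz zeta value. -/
noncomputable def hurwitzSum (m : ℕ) (x : ℝ) : ℝ := ∑' n : ℕ, ((x + n) ^ m)⁻¹

/-- The digamma function up to an additive constant. -/
noncomputable def psiSeries (x : ℝ) : ℝ := ∑' n : ℕ, (((n : ℝ) + 1)⁻¹ - (x + n)⁻¹)

theorem summable_hurwitz {m : ℕ} (hm : 2 ≤ m) {x : ℝ} (hx : 0 < x) :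
    Summable fun n : ℕ => ((x + n) ^ m)⁻¹ := by
  refine ((Real.summable_one_div_nat_add_rpow x m).2 (by exact_mod_cast hm)).congr fun n => ?_
  rw [abs_of_pos (by positivity), Real.rpow_natCast, one_div, add_comm]

theorem hasDerivAt_inv_pow_shift (c : ℝ) (m n : ℕ) {y : ℝ} (hy : 0 < y) :
    HasDerivAt (fun y : ℝ => c - ((y + n) ^ m)⁻¹) (m * ((y + n) ^ (m + 1))⁻¹) y := by
  have hpos : 0 < y + n := by positivity
  have h := ((((hasDerivAt_id y).add_const (n : ℝ)).pow m).inv (pow_pos hpos m).ne').const_sub c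
  refine h.congr_deriv ?_
  simp only [id, Pi.pow_apply]
  rcases m with _ | m
  · simp
  · simp only [Nat.add_sub_cancel]
    field_simp
    ring

theorem summable_bound_hurwitz {m : ℕ} (hm : 1 ≤ m) {δ : ℝ} (hδ : 0 < δ) :
    (Summable fun n : ℕ => (m : ℝ) * ((δ + n) ^ (m + 1))⁻¹) ∧
      ∀ (n : ℕ), ∀ y ∈ Set.Ioi δ, ‖(m : ℝ) * ((y + n) ^ (m + 1))⁻¹‖ ≤
        (m : ℝ) * ((δ + n) ^ (m + 1))⁻¹ := by
  refine ⟨(summable_hurwitz (by omega) hδ).mul_left _, fun n y hy => ?_⟩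
  have hy' : 0 < y := hδ.trans hy
  rw [Real.norm_eq_abs, abs_of_nonneg (by positivity)]
  have : δ ≤ y := (Set.mem_Ioi.1 hy).le
  gcongr

theorem summable_sub_hurwitz {m : ℕ} (hm : 1 ≤ m) (c : ℕ → ℝ) {x₀ x : ℝ} (hx₀ : 0 < x₀)
    (hx : 0 < x) (hs : Summable fun n : ℕ => c n - ((x₀ + n) ^ m)⁻¹) :
    Summable fun n : ℕ => c n - ((x + n) ^ m)⁻¹ := by
  have hδ : 0 < min x₀ x / 2 := by positivity
  obtain ⟨h1, h2⟩ := summable_bound_hurwitz hm hδ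
  exact summable_of_summable_hasDerivAt_of_isPreconnected
    (g := fun (n : ℕ) (y : ℝ) => c n - ((y + n) ^ m)⁻¹) h1 isOpen_Ioi
    isPreconnected_Ioi (fun n y hy => hasDerivAt_inv_pow_shift (c n) m n (hδ.trans hy)) h2
    (show x₀ ∈ Set.Ioi (min x₀ x / 2) by
      have := min_le_left x₀ x; simp only [Set.mem_Ioi]; linarith) hs
    (by have := min_le_right x₀ x; simp only [Set.mem_Ioi]; linarith)

/-- Termwise differentiation. The constants `c n` cover both uses: `1 / (n + 1)` for `psiSeries`,
where they ensure convergence, and `0` for the Hurwitz sums. -/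
theorem hasDerivAt_tsum_sub_hurwitz {m : ℕ} (hm : 1 ≤ m) (c : ℕ → ℝ) {x : ℝ} (hx : 0 < x)
    (hs : Summable fun n : ℕ => c n - ((x + n) ^ m)⁻¹) :
    HasDerivAt (fun x : ℝ => ∑' n : ℕ, (c n - ((x + n) ^ m)⁻¹)) (m * hurwitzSum (m + 1) x) x := by
  have hδ : 0 < x / 2 := by positivity
  obtain ⟨h1, h2⟩ := summable_bound_hurwitz hm hδ
  have hmem : x ∈ Set.Ioi (x / 2) := by simp only [Set.mem_Ioi]; linarith
  rw [hurwitzSum, ← tsum_mul_left]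
  exact hasDerivAt_tsum_of_isPreconnected (g := fun (n : ℕ) (y : ℝ) => c n - ((y + n) ^ m)⁻¹) h1 isOpen_Ioi
    isPreconnected_Ioi (fun n y hy => hasDerivAt_inv_pow_shift (c n) m n (hδ.trans hy)) h2
    hmem hs hmem

theorem summable_psi {x : ℝ} (hx : 0 < x) :
    Summable fun n : ℕ => ((n : ℝ) + 1)⁻¹ - (x + n)⁻¹ := by
  have := summable_sub_hurwitz (le_refl 1) (fun n : ℕ => ((n : ℝ) + 1)⁻¹) one_pos hx (by
    simp [add_comm])
  simpa using this

theorem hasDerivAt_psiSeries {x : ℝ} (hx : 0 < x) :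
    HasDerivAt psiSeries (hurwitzSum 2 x) x := by
  have := hasDerivAt_tsum_sub_hurwitz (le_refl 1) (fun n : ℕ => ((n : ℝ) + 1)⁻¹) hx (by
    simpa using summable_psi hx)
  have e : (fun x : ℝ => ∑' n : ℕ, (((n : ℝ) + 1)⁻¹ - ((x + n) ^ 1)⁻¹)) = psiSeries := by
    ext y
    simp [psiSeries]
  rw [e] at this
  simpa using this

theorem hasDerivAt_hurwitzSum {m : ℕ} (hm : 2 ≤ m) {x : ℝ} (hx : 0 < x) :
    HasDerivAt (hurwitzSum m) (-(m * hurwitzSum (m + 1) x)) x := by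
  have h := (hasDerivAt_tsum_sub_hurwitz (by omega : 1 ≤ m) (fun _ => 0) hx (by
    simpa using (summable_hurwitz hm hx).neg)).neg
  have e : (-fun x : ℝ => ∑' n : ℕ, ((0 : ℝ) - ((x + n) ^ m)⁻¹)) = hurwitzSum m := by
    ext y
    simp [hurwitzSum, tsum_neg]
  rwa [e] at h

theorem psiSeries_one : psiSeries 1 = 0 := by
  simp [psiSeries, add_comm]

/-- The difference of the two series telescopes. With `psiSeries_one` it makes the values at
positive integers harmonic numbers. -/
theorem psiSeries_add_one {x : ℝ} (hx : 0 < x) : psiSeries (x + 1) = psiSeries x + x⁻¹ := by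
  have h1 := ((summable_psi (by linarith : 0 < x + 1)).hasSum.sub (summable_psi hx).hasSum)
  have h2 := h1.tendsto_sum_nat
  have e : ∀ N : ℕ, ∑ n ∈ Finset.range N,
      ((((n : ℝ) + 1)⁻¹ - (x + 1 + n)⁻¹) - (((n : ℝ) + 1)⁻¹ - (x + n)⁻¹)) = x⁻¹ - (x + N)⁻¹ := by
    intro N
    have := Finset.sum_range_sub' (fun n : ℕ => (x + n)⁻¹) N
    simp only [Nat.cast_zero, add_zero] at this
    rw [← this]
    refine Finset.sum_congr rfl fun n _ => ?_
    push_cast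
    rw [show x + 1 + n = x + (n + 1) by ring]
    ring
  simp only [e] at h2
  have h3 : Tendsto (fun N : ℕ => x⁻¹ - (x + N)⁻¹) atTop (𝓝 (x⁻¹ - 0)) :=
    (tendsto_inv_atTop_zero.comp
      (tendsto_atTop_add_const_left _ _ tendsto_natCast_atTop_atTop)).const_sub _
  have := tendsto_nhds_unique h2 h3
  simp only [psiSeries]
  linarith

theorem psiSeries_mem (a : ℕ) : psiSeries ((a + 1 : ℕ) : ℝ) ∈ zetaAlgebra := by
  induction a with
  | zero => simp [psiSeries_one, zetaAlgebra.zero_mem]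
  | succ a ih =>
    rw [Nat.cast_succ, psiSeries_add_one (by positivity)]
    refine zetaAlgebra.add_mem ih ?_
    have := zetaAlgebra.algebraMap_mem (((a + 1 : ℕ) : ℚ)⁻¹)
    simpa using this

theorem hurwitzSum_mem {m : ℕ} (hm : 2 ≤ m) (a : ℕ) :
    hurwitzSum m ((a + 1 : ℕ) : ℝ) ∈ zetaAlgebra := by
  have hs : Summable fun n : ℕ => 1 / (n : ℝ) ^ m := Real.summable_one_div_nat_pow.2 (by omega)
  have h := hs.sum_add_tsum_nat_add (a + 1)
  -- The summand at index `0` is `1 / 0 = 0`, so including it is harmless.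
  have e : hurwitzSum m ((a + 1 : ℕ) : ℝ) = ∑' n : ℕ, 1 / (n : ℝ) ^ m -
      ∑ i ∈ Finset.range (a + 1), 1 / (i : ℝ) ^ m := by
    rw [← h, add_sub_cancel_left, hurwitzSum]
    refine tsum_congr fun n => ?_
    rw [one_div]
    push_cast
    congr 2
    ring
  rw [e]
  refine zetaAlgebra.sub_mem ?_ (zetaAlgebra.sum_mem fun i _ => ?_)
  · rw [mem_zetaAlgebra]
    obtain ⟨k, rfl⟩ : ∃ k, m = k + 2 := ⟨m - 2, by omega⟩
    refine ⟨MvPolynomial.X k, ?_⟩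
    have := zeta_nat_eq_tsum_of_gt_one (k := k + 2) (by omega)
    rw [MvPolynomial.aeval_X]
    push_cast at this ⊢
    rw [this]
  · have := zetaAlgebra.algebraMap_mem (1 / (i : ℚ) ^ m)
    simpa using this

/-! ### The differential ring of logarithmic derivatives of Beta. -/

/-- A differential ring of functions of two variables that contains the logarithmic derivatives of
the Beta function. -/
inductive BetaRing : (ℝ → ℝ → ℝ) → Prop
  | const (q : ℚ) : BetaRing fun _ _ => (q : ℝ)
  | add {F G : ℝ → ℝ → ℝ} : BetaRing F → BetaRing G → BetaRing fun x y => F x y + G x y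
  | mul {F G : ℝ → ℝ → ℝ} : BetaRing F → BetaRing G → BetaRing fun x y => F x y * G x y
  | psi_left : BetaRing fun x y => psiSeries x - psiSeries (x + y)
  | psi_right : BetaRing fun x y => psiSeries y - psiSeries (x + y)
  | hurwitz_left (m : ℕ) (hm : 2 ≤ m) : BetaRing fun x _ => hurwitzSum m x
  | hurwitz_right (m : ℕ) (hm : 2 ≤ m) : BetaRing fun _ y => hurwitzSum m y
  | hurwitz_add (m : ℕ) (hm : 2 ≤ m) : BetaRing fun x y => hurwitzSum m (x + y)

theorem BetaRing.swap {F : ℝ → ℝ → ℝ} (hF : BetaRing F) : BetaRing fun x y => F y x := by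
  induction hF with
  | const q => exact .const q
  | add _ _ h1 h2 => exact h1.add h2
  | mul _ _ h1 h2 => exact h1.mul h2
  | psi_left => simpa only [add_comm] using BetaRing.psi_right
  | psi_right => simpa only [add_comm] using BetaRing.psi_left
  | hurwitz_left m hm => exact .hurwitz_right m hm
  | hurwitz_right m hm => exact .hurwitz_left m hm
  | hurwitz_add m hm => simpa only [add_comm] using BetaRing.hurwitz_add m hm

theorem BetaRing.neg {F : ℝ → ℝ → ℝ} (hF : BetaRing F) : BetaRing fun x y => -F x y := by
  simpa using (BetaRing.const (-1)).mul hF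

/-- Differentiating a digamma difference gives Hurwitz sums of order `2`, and differentiating a
Hurwitz sum raises its order, so no new generators appear. -/
theorem BetaRing.exists_deriv {F : ℝ → ℝ → ℝ} (hF : BetaRing F) :
    ∃ F', BetaRing F' ∧ ∀ x y : ℝ, 0 < x → 0 < y → HasDerivAt (fun x => F x y) (F' x y) x := by
  induction hF with
  | const q => exact ⟨_, .const 0, fun x y _ _ => by simpa using hasDerivAt_const x (q : ℝ)⟩
  | add _ _ h1 h2 =>
    obtain ⟨F', hF', h1⟩ := h1
    obtain ⟨G', hG', h2⟩ := h2
    exact ⟨_, hF'.add hG', fun x y hx hy => (h1 x y hx hy).add (h2 x y hx hy)⟩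
  | mul hF hG h1 h2 =>
    obtain ⟨F', hF', h1⟩ := h1
    obtain ⟨G', hG', h2⟩ := h2
    exact ⟨_, (hF'.mul hG).add (hF.mul hG'), fun x y hx hy => (h1 x y hx hy).mul (h2 x y hx hy)⟩
  | psi_left =>
    refine ⟨_, (BetaRing.hurwitz_left 2 le_rfl).add (BetaRing.hurwitz_add 2 le_rfl).neg,
      fun x y hx hy => ?_⟩
    simp only [← sub_eq_add_neg]
    exact
      (hasDerivAt_psiSeries hx).sub ((hasDerivAt_psiSeries (add_pos hx hy)).comp_add_const x y)
  | psi_right =>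
    refine ⟨_, (BetaRing.hurwitz_add 2 le_rfl).neg, fun x y hx hy => ?_⟩
    exact ((hasDerivAt_psiSeries (add_pos hx hy)).comp_add_const x y).const_sub _
  | hurwitz_left m hm =>
    refine ⟨_, ((BetaRing.const m).mul (.hurwitz_left (m + 1) (by omega))).neg,
      fun x y hx hy => ?_⟩
    simpa using hasDerivAt_hurwitzSum hm hx
  | hurwitz_right m hm =>
    exact ⟨_, .const 0, fun x y _ _ => by simpa using hasDerivAt_const x (hurwitzSum m y)⟩
  | hurwitz_add m hm =>
    refine ⟨_, ((BetaRing.const m).mul (.hurwitz_add (m + 1) (by omega))).neg,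
      fun x y hx hy => ?_⟩
    simpa using (hasDerivAt_hurwitzSum hm (add_pos hx hy)).comp_add_const x y

theorem BetaRing.mem_zetaAlgebra {F : ℝ → ℝ → ℝ} (hF : BetaRing F) (a b : ℕ) :
    F ((a + 1 : ℕ) : ℝ) ((b + 1 : ℕ) : ℝ) ∈ zetaAlgebra := by
  have hab : ((a + 1 : ℕ) : ℝ) + ((b + 1 : ℕ) : ℝ) = ((a + b + 1 + 1 : ℕ) : ℝ) := by
    push_cast; ring
  induction hF with
  | const q => exact zetaAlgebra.algebraMap_mem q
  | add _ _ h1 h2 => exact zetaAlgebra.add_mem h1 h2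
  | mul _ _ h1 h2 => exact zetaAlgebra.mul_mem h1 h2
  | psi_left => simpa only [hab] using zetaAlgebra.sub_mem (psiSeries_mem _) (psiSeries_mem _)
  | psi_right => simpa only [hab] using zetaAlgebra.sub_mem (psiSeries_mem _) (psiSeries_mem _)
  | hurwitz_left m hm => exact hurwitzSum_mem hm _
  | hurwitz_right m hm => exact hurwitzSum_mem hm _
  | hurwitz_add m hm => simpa only [hab] using hurwitzSum_mem hm _

/-! ### Beta integrals with logarithms. -/

/-- The integrand `t ^ (x - 1) * (1 - t) ^ (y - 1) * log t ^ k * log (1 - t) ^ l`. -/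
noncomputable def betaLogKernel (k l : ℕ) (x y t : ℝ) : ℝ :=
  t ^ (x - 1) * (1 - t) ^ (y - 1) * Real.log t ^ k * Real.log (1 - t) ^ l

/-- The partial derivatives of the Beta function, as integrals. -/
noncomputable def betaLogIntegral (k l : ℕ) (x y : ℝ) : ℝ :=
  ∫ t in Set.Ioo (0 : ℝ) 1, betaLogKernel k l x y t

theorem measurable_betaLogKernel (k l : ℕ) (x y : ℝ) : Measurable (betaLogKernel k l x y) := by
  unfold betaLogKernel
  fun_prop

theorem cpow_mul_cpow_eq {t : ℝ} (ht : t ∈ Set.Ioo (0 : ℝ) 1) (x y : ℝ) :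
    (t : ℂ) ^ ((x : ℂ) - 1) * (1 - (t : ℂ)) ^ ((y : ℂ) - 1) =
      ((betaLogKernel 0 0 x y t : ℝ) : ℂ) := by
  simp only [betaLogKernel, pow_zero, mul_one]
  rw [Complex.ofReal_mul, Complex.ofReal_cpow ht.1.le, Complex.ofReal_cpow (sub_nonneg.2 ht.2.le)]
  push_cast
  rfl

theorem integrableOn_beta {x y : ℝ} (hx : 0 < x) (hy : 0 < y) :
    IntegrableOn (betaLogKernel 0 0 x y) (Set.Ioo 0 1) := by
  have h := Complex.betaIntegral_convergent (u := x) (v := y) (by simpa) (by simpa)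
  rw [intervalIntegrable_iff_integrableOn_Ioo_of_le zero_le_one] at h
  have h2 := (integrableOn_congr_fun (fun t ht => cpow_mul_cpow_eq ht x y) measurableSet_Ioo).1 h
  exact h2.re

theorem betaLogIntegral_zero {x y : ℝ} (hx : 0 < x) (hy : 0 < y) :
    betaLogIntegral 0 0 x y = ProbabilityTheory.beta x y := by
  rw [ProbabilityTheory.beta_eq_betaIntegralReal x y hx hy, Complex.betaIntegral,
    intervalIntegral.integral_of_le zero_le_one, integral_Ioc_eq_integral_Ioo,
    setIntegral_congr_fun measurableSet_Ioo (fun t ht => cpow_mul_cpow_eq ht x y),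
    integral_complex_ofReal, Complex.ofReal_re]
  rfl

theorem abs_log_pow_le (k : ℕ) {ε t : ℝ} (hε : 0 < ε) (h0 : 0 < t) (h1 : t < 1) :
    |Real.log t| ^ k ≤ k.factorial / ε ^ k * t ^ (-ε) := by
  have hl : Real.log t < 0 := Real.log_neg h0 h1
  have h := Real.pow_div_factorial_le_exp (ε * |Real.log t|) (by positivity) k
  have e : Real.exp (ε * |Real.log t|) = t ^ (-ε) := by
    rw [Real.rpow_def_of_pos h0, abs_of_neg hl]
    congr 1
    ring
  rw [e, mul_pow, div_le_iff₀ (by positivity)] at h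
  rw [div_mul_eq_mul_div, le_div_iff₀ (by positivity)]
  linarith

/-- The powers of the logarithms are absorbed by giving up half of each exponent `x₁` and `y`.
Uniformity in `x ≥ x₁` is what differentiation under the integral requires. -/
theorem exists_kernel_bound (k l : ℕ) {x₁ y : ℝ} (hx₁ : 0 < x₁) (hy : 0 < y) :
    ∃ C : ℝ, ∀ x, x₁ ≤ x → ∀ t ∈ Set.Ioo (0 : ℝ) 1,
      ‖betaLogKernel k l x y t‖ ≤ C * betaLogKernel 0 0 (x₁ / 2) (y / 2) t := by
  refine ⟨(k.factorial / (x₁ / 2) ^ k) * (l.factorial / (y / 2) ^ l), fun x hx t ht => ?_⟩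
  have ht' : 0 < 1 - t := sub_pos.2 ht.2
  have h1 := abs_log_pow_le k (half_pos hx₁) ht.1 ht.2
  have h2 := abs_log_pow_le l (half_pos hy) ht' (by linarith [ht.1])
  have h3 : t ^ (x - 1) ≤ t ^ (x₁ - 1) := Real.rpow_le_rpow_of_exponent_ge ht.1 ht.2.le (by linarith)
  have p1 : t ^ (x₁ - 1) * t ^ (-(x₁ / 2)) = t ^ (x₁ / 2 - 1) := by
    rw [← Real.rpow_add ht.1]; congr 1; ring
  have p2 : (1 - t) ^ (y - 1) * (1 - t) ^ (-(y / 2)) = (1 - t) ^ (y / 2 - 1) := by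
    rw [← Real.rpow_add ht']; congr 1; ring
  have q0 := Real.rpow_nonneg ht.1.le (x - 1)
  have q1 := Real.rpow_nonneg ht.1.le (x₁ - 1)
  have q2 := Real.rpow_nonneg ht'.le (y - 1)
  have q3 := Real.rpow_nonneg ht.1.le (-(x₁ / 2))
  simp only [betaLogKernel, pow_zero, mul_one]
  rw [norm_mul, norm_mul, norm_mul, norm_pow, norm_pow, Real.norm_eq_abs, Real.norm_eq_abs,
    Real.norm_eq_abs, Real.norm_eq_abs, abs_of_nonneg q0, abs_of_nonneg q2, ← p1, ← p2]
  calc _ ≤ t ^ (x₁ - 1) * (1 - t) ^ (y - 1) * (k.factorial / (x₁ / 2) ^ k * t ^ (-(x₁ / 2))) *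
        (l.factorial / (y / 2) ^ l * (1 - t) ^ (-(y / 2))) := by gcongr
    _ = _ := by ring

theorem integrableOn_betaLogKernel (k l : ℕ) {x y : ℝ} (hx : 0 < x) (hy : 0 < y) :
    IntegrableOn (betaLogKernel k l x y) (Set.Ioo 0 1) := by
  obtain ⟨C, hC⟩ := exists_kernel_bound k l hx hy
  refine Integrable.mono' ((integrableOn_beta (half_pos hx) (half_pos hy)).const_mul C)
    (measurable_betaLogKernel _ _ _ _).aestronglyMeasurable ?_
  exact (ae_restrict_iff' measurableSet_Ioo).2 (Eventually.of_forall fun t ht => hC x le_rfl t ht)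

theorem hasDerivAt_betaLogIntegral (k l : ℕ) {x y : ℝ} (hx : 0 < x) (hy : 0 < y) :
    HasDerivAt (fun x => betaLogIntegral k l x y) (betaLogIntegral (k + 1) l x y) x := by
  obtain ⟨C, hC⟩ := exists_kernel_bound (k + 1) l (half_pos hx) hy
  refine (hasDerivAt_integral_of_dominated_loc_of_deriv_le (s := Set.Ioi (x / 2))
    (bound := fun t => C * betaLogKernel 0 0 (x / 2 / 2) (y / 2) t)
    (F := fun x t => betaLogKernel k l x y t)
    (F' := fun x t => betaLogKernel (k + 1) l x y t)
    (Ioi_mem_nhds (half_lt_self hx))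
    (Eventually.of_forall fun x => (measurable_betaLogKernel _ _ _ _).aestronglyMeasurable)
    (integrableOn_betaLogKernel k l hx hy)
    (measurable_betaLogKernel _ _ _ _).aestronglyMeasurable ?_
    ((integrableOn_beta (half_pos (half_pos hx)) (half_pos hy)).const_mul C) ?_).2
  · exact (ae_restrict_iff' measurableSet_Ioo).2 (Eventually.of_forall fun t ht x' hx' =>
      hC x' (Set.mem_Ioi.1 hx').le t ht)
  · refine (ae_restrict_iff' measurableSet_Ioo).2 (Eventually.of_forall fun t ht x' hx' => ?_)
    have h := ((((hasDerivAt_id x').sub_const 1).const_rpow ht.1).mul_const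
      ((1 - t) ^ (y - 1))).mul_const (Real.log t ^ k) |>.mul_const (Real.log (1 - t) ^ l)
    refine h.congr_deriv ?_
    simp only [betaLogKernel, id]
    ring

theorem betaLogIntegral_swap (k l : ℕ) (x y : ℝ) :
    betaLogIntegral k l x y = betaLogIntegral l k y x := by
  simp only [betaLogIntegral]
  rw [← integral_Ioc_eq_integral_Ioo, ← integral_Ioc_eq_integral_Ioo,
    ← intervalIntegral.integral_of_le zero_le_one, ← intervalIntegral.integral_of_le zero_le_one]
  have := intervalIntegral.integral_comp_sub_left (a := 0) (b := 1) (betaLogKernel l k y x) 1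
  rw [sub_zero, sub_self] at this
  rw [← this]
  refine intervalIntegral.integral_congr fun t _ => ?_
  simp only [betaLogKernel, sub_sub_cancel]
  ring

theorem betaLogIntegral_pos {x y : ℝ} (hx : 0 < x) (hy : 0 < y) : 0 < betaLogIntegral 0 0 x y := by
  rw [betaLogIntegral_zero hx hy]
  exact ProbabilityTheory.beta_pos hx hy

theorem beta_add_one {x y : ℝ} (hx : 0 < x) (hy : 0 < y) :
    (x + y) * betaLogIntegral 0 0 (x + 1) y = x * betaLogIntegral 0 0 x y := by
  rw [betaLogIntegral_zero hx hy, betaLogIntegral_zero (by linarith) hy, ProbabilityTheory.beta,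
    ProbabilityTheory.beta, Real.Gamma_add_one hx.ne', show x + 1 + y = x + y + 1 by ring,
    Real.Gamma_add_one (by positivity : x + y ≠ 0)]
  have := (Real.Gamma_pos_of_pos (add_pos hx hy)).ne'
  have : x + y ≠ 0 := by positivity
  field_simp

theorem beta_shift {x y : ℝ} (hx : 0 < x) (hy : 0 < y) :
    x * betaLogIntegral 0 0 x (y + 1) = y * betaLogIntegral 0 0 (x + 1) y := by
  rw [betaLogIntegral_zero (by linarith) hy, betaLogIntegral_zero hx (by linarith),
    ProbabilityTheory.beta, ProbabilityTheory.beta, Real.Gamma_add_one hx.ne',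
    Real.Gamma_add_one hy.ne', show x + 1 + y = x + (y + 1) by ring]
  ring

/-- The logarithmic derivative of the Beta function in its first argument. -/
noncomputable def betaLogDeriv (x y : ℝ) : ℝ :=
  betaLogIntegral 1 0 x y / betaLogIntegral 0 0 x y

/-- This is the logarithmic derivative in `x` of the functional equation `beta_add_one`. -/
theorem betaLogDeriv_add_one {x y : ℝ} (hx : 0 < x) (hy : 0 < y) :
    betaLogDeriv (x + 1) y = betaLogDeriv x y - ((x + y)⁻¹ - x⁻¹) := by
  have h1 : HasDerivAt (fun x => (x + y) * betaLogIntegral 0 0 (x + 1) y)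
      (1 * betaLogIntegral 0 0 (x + 1) y + (x + y) * betaLogIntegral 1 0 (x + 1) y) x :=
    ((hasDerivAt_id x).add_const y).mul
      ((hasDerivAt_betaLogIntegral 0 0 (x := x + 1) (by linarith) hy).comp_add_const x 1)
  have h2 : HasDerivAt (fun x => x * betaLogIntegral 0 0 x y)
      (1 * betaLogIntegral 0 0 x y + x * betaLogIntegral 1 0 x y) x :=
    (hasDerivAt_id x).mul (hasDerivAt_betaLogIntegral 0 0 hx hy)
  have h3 := h1.unique (h2.congr_of_eventuallyEq (by
    filter_upwards [Ioi_mem_nhds hx] with z hz using beta_add_one hz hy))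
  have e := beta_add_one hx hy
  have p1 := (betaLogIntegral_pos hx hy).ne'
  have p2 := (betaLogIntegral_pos (by linarith : 0 < x + 1) hy).ne'
  have hxy : x + y ≠ 0 := by positivity
  have eB : betaLogIntegral 0 0 x y = (x + y) * betaLogIntegral 0 0 (x + 1) y / x := by
    rw [e]; field_simp
  have eJ : betaLogIntegral 1 0 x y = (1 * betaLogIntegral 0 0 (x + 1) y +
      (x + y) * betaLogIntegral 1 0 (x + 1) y - betaLogIntegral 0 0 x y) / x := by
    rw [h3]; field_simp; ring
  rw [betaLogDeriv, betaLogDeriv, eJ, eB]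
  field_simp
  ring

/-- Since `|log t| ≤ (1 - t) / t`, the integrand at `(x + 1, y)` is dominated by the Beta integrand
at `(x, y + 1)`, and the ratio of the two Beta values is `y / x`. -/
theorem abs_betaLogDeriv_le {x y : ℝ} (hx : 0 < x) (hy : 0 < y) :
    |betaLogDeriv (x + 1) y| ≤ y / x := by
  have p2 := betaLogIntegral_pos (by linarith : 0 < x + 1) hy
  rw [betaLogDeriv, abs_div, abs_of_pos p2, div_le_div_iff₀ p2 hx, mul_comm, ← beta_shift hx hy]
  refine mul_le_mul_of_nonneg_left ?_ hx.le
  rw [← Real.norm_eq_abs]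
  refine (norm_integral_le_integral_norm _).trans ?_
  refine setIntegral_mono_on (integrableOn_betaLogKernel 1 0 (by linarith) hy).norm
    (integrableOn_betaLogKernel 0 0 hx (by linarith)) measurableSet_Ioo fun t ht => ?_
  have ht' : 0 < 1 - t := sub_pos.2 ht.2
  have hlog : |Real.log t| ≤ t⁻¹ * (1 - t) := by
    rw [abs_of_neg (Real.log_neg ht.1 ht.2)]
    have := Real.one_sub_inv_le_log_of_pos ht.1
    have e : t⁻¹ * (1 - t) = t⁻¹ - 1 := by
      rw [mul_sub, inv_mul_cancel₀ ht.1.ne', mul_one]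
    linarith
  have q1 := Real.rpow_nonneg ht.1.le x
  have q2 := Real.rpow_nonneg ht'.le (y - 1)
  simp only [betaLogKernel, pow_zero, mul_one, pow_one, add_sub_cancel_right]
  rw [norm_mul, Real.norm_eq_abs, Real.norm_eq_abs, abs_of_nonneg (mul_nonneg q1 q2),
    Real.rpow_sub_one ht.1.ne']
  calc _ ≤ t ^ x * (1 - t) ^ (y - 1) * (t⁻¹ * (1 - t)) := by gcongr
    _ = t ^ x / t * ((1 - t) ^ (y - 1) * (1 - t)) := by ring
    _ = _ := by rw [← Real.rpow_add_one ht'.ne', sub_add_cancel]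

/-- The partial sums of the digamma difference telescope by the shift relation, and the remainder at
`x + N` tends to zero. -/
theorem betaLogDeriv_eq {x y : ℝ} (hx : 0 < x) (hy : 0 < y) :
    betaLogDeriv x y = psiSeries x - psiSeries (x + y) := by
  have h := ((summable_psi hx).hasSum.sub (summable_psi (add_pos hx hy)).hasSum).tendsto_sum_nat
  have hrec : ∀ N : ℕ, ∑ n ∈ Finset.range N,
      ((((n : ℝ) + 1)⁻¹ - (x + n)⁻¹) - (((n : ℝ) + 1)⁻¹ - (x + y + n)⁻¹)) =
      betaLogDeriv x y - betaLogDeriv (x + N) y := by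
    intro N
    induction N with
    | zero => simp
    | succ N ih =>
      rw [Finset.sum_range_succ, ih, Nat.cast_succ, ← add_assoc,
        betaLogDeriv_add_one (by positivity) hy, show x + N + y = x + y + N by ring]
      ring
  simp only [hrec] at h
  have hlim : Tendsto (fun N : ℕ => betaLogDeriv (x + N) y) atTop (𝓝 0) := by
    rw [← tendsto_add_atTop_iff_nat 1]
    refine squeeze_zero_norm (a := fun N : ℕ => y / (x + N)) (fun N => ?_) ?_
    · rw [Real.norm_eq_abs, Nat.cast_succ, ← add_assoc]
      exact abs_betaLogDeriv_le (by positivity) hy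
    · exact tendsto_const_nhds.div_atTop
        (tendsto_atTop_add_const_left _ _ tendsto_natCast_atTop_atTop)
  have := tendsto_nhds_unique h (hlim.const_sub (betaLogDeriv x y))
  rw [sub_zero] at this
  exact this.symm

/-- If a derivative of Beta `B` is `B * P`, the next one in `x` is `B * ((ψ(x) - ψ(x + y)) P +
∂P/∂x)`. Derivatives in `y` come from symmetry: first `(l, 0)`, then the swap to `(0, l)`, then `k`
steps in `x`. -/
theorem exists_betaRing (k l : ℕ) : ∃ P, BetaRing P ∧ ∀ x y : ℝ, 0 < x → 0 < y →
    betaLogIntegral k l x y = betaLogIntegral 0 0 x y * P x y := by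
  have hstep : ∀ k l : ℕ, (∃ P, BetaRing P ∧ ∀ x y : ℝ, 0 < x → 0 < y →
      betaLogIntegral k l x y = betaLogIntegral 0 0 x y * P x y) →
      ∃ P, BetaRing P ∧ ∀ x y : ℝ, 0 < x → 0 < y →
        betaLogIntegral (k + 1) l x y = betaLogIntegral 0 0 x y * P x y := by
    rintro k l ⟨P, hP, h⟩
    obtain ⟨P', hP', hd⟩ := hP.exists_deriv
    refine ⟨_, (BetaRing.psi_left.mul hP).add hP', fun x y hx hy => ?_⟩
    have h1 := (hasDerivAt_betaLogIntegral 0 0 hx hy).mul (hd x y hx hy)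
    have h2 := (hasDerivAt_betaLogIntegral k l hx hy).unique (h1.congr_of_eventuallyEq (by
      filter_upwards [Ioi_mem_nhds hx] with z hz using h z y hz hy))
    have h3 : betaLogIntegral 1 0 x y =
        betaLogIntegral 0 0 x y * (psiSeries x - psiSeries (x + y)) := by
      rw [← betaLogDeriv_eq hx hy, betaLogDeriv, mul_div_cancel₀ _ (betaLogIntegral_pos hx hy).ne']
    rw [h2, zero_add, h3]
    ring
  have hswap : ∀ k l : ℕ, (∃ P, BetaRing P ∧ ∀ x y : ℝ, 0 < x → 0 < y →
      betaLogIntegral k l x y = betaLogIntegral 0 0 x y * P x y) →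
      ∃ P, BetaRing P ∧ ∀ x y : ℝ, 0 < x → 0 < y →
        betaLogIntegral l k x y = betaLogIntegral 0 0 x y * P x y := by
    rintro k l ⟨P, hP, h⟩
    refine ⟨_, hP.swap, fun x y hx hy => ?_⟩
    rw [betaLogIntegral_swap, h y x hy hx, betaLogIntegral_swap]
  have h0 : ∀ l : ℕ, ∃ P, BetaRing P ∧ ∀ x y : ℝ, 0 < x → 0 < y →
      betaLogIntegral l 0 x y = betaLogIntegral 0 0 x y * P x y := by
    intro l
    induction l with
    | zero => exact ⟨_, .const 1, fun x y _ _ => by simp⟩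
    | succ l ih => exact hstep l 0 ih
  induction k with
  | zero => exact hswap l 0 (h0 l)
  | succ k ih => exact hstep k l ih

/-! ### Evaluation at positive integers and the conclusion. -/

theorem beta_nat_mem (a b : ℕ) :
    betaLogIntegral 0 0 ((a + 1 : ℕ) : ℝ) ((b + 1 : ℕ) : ℝ) ∈ zetaAlgebra := by
  rw [betaLogIntegral_zero (by positivity) (by positivity), ProbabilityTheory.beta, ← Nat.cast_add,
    show a + 1 + (b + 1) = (a + b + 1) + 1 by ring, Nat.cast_succ a, Nat.cast_succ b,
    Nat.cast_succ (a + b + 1), Real.Gamma_nat_eq_factorial, Real.Gamma_nat_eq_factorial,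
    Real.Gamma_nat_eq_factorial]
  have := zetaAlgebra.algebraMap_mem (a.factorial * b.factorial / (a + b + 1).factorial : ℚ)
  simpa using this

theorem betaLogIntegral_nat_mem (k l a b : ℕ) :
    betaLogIntegral k l ((a + 1 : ℕ) : ℝ) ((b + 1 : ℕ) : ℝ) ∈ zetaAlgebra := by
  obtain ⟨P, hP, h⟩ := exists_betaRing k l
  rw [h _ _ (by positivity) (by positivity)]
  exact zetaAlgebra.mul_mem (beta_nat_mem a b) (hP.mem_zetaAlgebra a b)

theorem betaLogKernel_nat (k l a b : ℕ) (t : ℝ) :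
    betaLogKernel k l ((a + 1 : ℕ) : ℝ) ((b + 1 : ℕ) : ℝ) t =
      t ^ a * (1 - t) ^ b * Real.log t ^ k * Real.log (1 - t) ^ l := by
  simp [betaLogKernel]

/-- Expanding the power of the toll gives terms with `(u log u) ^ q` and `((1 - u) log (1 - u)) ^ (j
- p)`, so each integral is a Beta derivative with shifted, still positive integer arguments. -/
theorem integral_limitToll_mem (k l j : ℕ) :
    ∫ u in Set.Ioo (0 : ℝ) 1, u ^ k * (1 - u) ^ l * limitToll u ^ j ∈ zetaAlgebra := by
  have hexp : ∀ u : ℝ, u ^ k * (1 - u) ^ l * limitToll u ^ j =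
      ∑ p ∈ Finset.range (j + 1), ∑ q ∈ Finset.range (p + 1),
        (algebraMap ℚ ℝ (j.choose p * p.choose q * 2 ^ q * 2 ^ (j - p))) *
        betaLogKernel q (j - p) ((k + q + 1 : ℕ) : ℝ) ((l + (j - p) + 1 : ℕ) : ℝ) u := by
    intro u
    simp only [betaLogKernel_nat]
    rw [limitToll, add_pow, Finset.mul_sum]
    refine Finset.sum_congr rfl fun p _ => ?_
    rw [add_comm (1 : ℝ), add_pow, Finset.sum_mul, Finset.sum_mul, Finset.mul_sum]
    refine Finset.sum_congr rfl fun q _ => ?_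
    simp only [eq_ratCast]
    push_cast
    simp only [mul_pow, one_pow, pow_add]
    ring
  have hint : ∀ p q : ℕ, IntegrableOn (betaLogKernel q (j - p) ((k + q + 1 : ℕ) : ℝ)
      ((l + (j - p) + 1 : ℕ) : ℝ)) (Set.Ioo 0 1) := fun p q =>
    integrableOn_betaLogKernel _ _ (by positivity) (by positivity)
  simp only [hexp]
  rw [integral_finsetSum _ fun p _ => integrable_finsetSum _ fun q _ => (hint p q).const_mul _]
  refine zetaAlgebra.sum_mem fun p _ => ?_
  rw [integral_finsetSum _ fun q _ => (hint p q).const_mul _]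
  refine zetaAlgebra.sum_mem fun q _ => ?_
  rw [integral_const_mul]
  exact zetaAlgebra.mul_mem (zetaAlgebra.algebraMap_mem _) (betaLogIntegral_nat_mem _ _ _ _)

theorem mainTheorem10 :
    ∃ μ : ProbabilityMeasure ℝ, IsQuicksortLimitLaw μ ∧
      ∀ s : ℕ, Integrable (fun z : ℝ => z ^ s) (μ : Measure ℝ) ∧
        IsRationalPolynomialInZetaValues (∫ z : ℝ, z ^ s ∂(μ : Measure ℝ)) := by
  obtain ⟨μ, hμ⟩ := exists_quicksortLimitLaw
  exact ⟨μ, hμ, fun s => ⟨hμ.integrable_pow s,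
    mem_zetaAlgebra.1 (hμ.moment_mem zetaAlgebra integral_limitToll_mem s)⟩⟩
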